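/- **Definitions.** A random function $f:[I]\to S$ ($S$ finite) is $k$-wise independent if each value $f(i)$ is uniformly distributed on $S$ and the values of $f$ at any at most $k$ distinct points are independent. Given a 3-wise independent $h:[I]\to[J]$ and a 4-wise independent $s:[I]\to\{-1,+1\}$, independent of each other, the *CountSketch* matrix $C\in\mathbb R^{J\times I}$ is $C(j,i)=s(i)\,\mathbf 1\{h(i)=j\}$. Given two such pairs $(h_1,s_1),(h_2,s_2)$ on $[J]$, all independent, the *degree-two TensorSketch* matrix $T\in\mathbb R^{J\times J^2}$ is $T(j,(i_1,i_2))=s_1(i_1)s_2(i_2)\,\mathbf 1\{(h_1(i_1)+h_2(i_2)\bmod J)+1=j\}$. Let $N\ge 1$, $I_1,\dots,I_N\ge1$, $q=\lceil\log_2N\rceil$, $I_{\max}=\max_j I_j$, $\tilde I_n=I_n$ for $n\le N$ and $\tilde I_n=I_{\max}$ for $N<n\le 2^q$. Take mutually independent CountSketches $C_n\in\mathbb R^{J\times\tilde I_n}$ ($n\in[2^q]$) and degree-two TensorSketches $T^{(m)}_n\in\mathbb R^{J\times J^2}$ ($m\in[q]$, $n\in[2^{q-m}]$), and put $T^{(m)}=\bigotimes_{n=1}^{2^{q-m}}T^{(m)}_n$.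 The *$(J,(I_j)_{j=1}^N)$-recursive sketch* is the random matrix $\Psi\in\mathbb R^{J\times\prod_jI_j}$ with $$\Psi x=T^{(q)}T^{(q-1)}\cdots T^{(1)}\Big(\bigotimes_{n=1}^{2^q}C_n\Big)\big(x\otimes e_1^{\otimes(2^q-N)}\big),$$ where $e_1$ is the first canonical basis vector of $\mathbb R^{I_{\max}}$. A matrix $\Psi$ is a *$\gamma$-subspace embedding* for $A\in\mathbb R^{\prod_j I_j\times R}$ if $\big|\|\Psi Ax\|_2^2-\|Ax\|_2^2\big|\le\gamma\|Ax\|_2^2$ for all $x\in\mathbb R^R$. **Corollary.** There is an absolute constant $C>0$ such that the following holds for all $N\ge1$, all mode sizes $I_1,\dots,I_N\ge1$ (not necessarily equal), all $R$, $J$, all $\gamma,\delta\in(0,1)$ and every $A\in\mathbb R^{\prod_{j=1}^NI_j\times R}$. If $$J\ \ge\ C\,\frac{NR^2}{\gamma^2\delta},$$ then a $(J,(I_j)_{j=1}^N)$-recursive sketch $\Psi$ is a $\gamma$-subspace embedding for $A$ with probability at least $1-\delta$. -/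

import Mathlib

open MeasureTheory ProbabilityTheory

/-- The random function `h : α → β` (with finite range `β`) is `k`-wise independent: its values are
uniformly distributed on `β`, and the values at any at most `k` distinct points are independent.
(If `α` has at least `k` points, it is the same to ask this for exactly `k` distinct points.) -/
structure KWiseIndependent {Ω α β : Type*} [MeasurableSpace Ω] [Fintype β] [MeasurableSpace β]
    (k : ℕ) (h : Ω → α → β) (μ : Measure Ω) : Prop where
  measurable : Measurable h
  uniform : ∀ (i : α) (v : β), μ.real {ω | h ω i = v} = 1 / (Fintype.card β : ℝ)
  indep : ∀ S : Finset α, S.card ≤ k → iIndepFun (fun (i : S) (ω : Ω) => h ω (i : α)) μ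

/-- The CountSketch matrix with hash function `h` and sign function `s`:
`C(j, i) = s(i) · 𝟙{h(i) = j}`. -/
def countSketch {I J : ℕ} (h : Fin I → Fin J) (s : Fin I → ℤˣ) : Matrix (Fin J) (Fin I) ℝ :=
  Matrix.of fun j i => ((s i : ℤ) : ℝ) * if h i = j then 1 else 0

/-- The degree-two TensorSketch matrix with hash functions `h₁, h₂` and sign functions `s₁, s₂`:
`T(j, (i₁, i₂)) = s₁(i₁) s₂(i₂) · 𝟙{h(i₁, i₂) = j}` with `h(i₁, i₂) = (h₁(i₁) + h₂(i₂) mod J) + 1`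
for values in `{1, …, J}`. The element `x : Fin J` stands for `x + 1 ∈ {1, …, J}`. -/
def tensorSketch {I J : ℕ} (h₁ h₂ : Fin I → Fin J) (s₁ s₂ : Fin I → ℤˣ) :
    Matrix (Fin J) (Fin I × Fin I) ℝ :=
  Matrix.of fun j i => ((s₁ i.1 : ℤ) : ℝ) * ((s₂ i.2 : ℤ) : ℝ) *
    if (((h₁ i.1 : ℕ) + 1) + ((h₂ i.2 : ℕ) + 1)) % J = (j : ℕ) then 1 else 0

/-- The Kronecker product `⨂ₙ Cₙ`, its rows and columns being indexed by multi-indices. -/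
def kronCount {K J : ℕ} {I : Fin K → ℕ} (C : ∀ n, Matrix (Fin J) (Fin (I n)) ℝ) :
    Matrix (Fin K → Fin J) (∀ n, Fin (I n)) ℝ :=
  Matrix.of fun r c => ∏ n, C n (r n) (c n)

/-- The Kronecker product `⨂ₙ Tₙ` of `2 ^ d` matrices of size `J × J²`; the `n`-th factor
combines the modes `2n` and `2n + 1` (counted from `0`) of the `2 ^ (d + 1)` input modes. -/
def kronTensor {J : ℕ} (d : ℕ) (T : Fin (2 ^ d) → Matrix (Fin J) (Fin J × Fin J) ℝ) :
    Matrix (Fin (2 ^ d) → Fin J) (Fin (2 ^ (d + 1)) → Fin J) ℝ :=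
  Matrix.of fun r c => ∏ n : Fin (2 ^ d),
    T n (r n) (c ⟨2 * (n : ℕ), by have := n.isLt; omega⟩,
      c ⟨2 * (n : ℕ) + 1, by have := n.isLt; omega⟩)

/-- The product `T⁽ᵠ⁾ ⋯ T⁽¹⁾`, where `T⁽ᵠ⁻ᵈ⁾ = ⨂ₙ T d n` has `2 ^ d` factors (so `d = 0` is the
last step, which leaves a single vector of length `J`); for `q = 0` it is the identity. -/
def tensorTree {J : ℕ} : (q : ℕ) →
    (T : (d : Fin q) → Fin (2 ^ (d : ℕ)) → Matrix (Fin J) (Fin J × Fin J) ℝ) →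
    Matrix (Fin J) (Fin (2 ^ q) → Fin J) ℝ
  | 0, _ => Matrix.of fun r c => if c ⟨0, by norm_num⟩ = r then 1 else 0
  | q + 1, T => tensorTree q (fun d n => T d.castSucc n) * kronTensor q (T (Fin.last q))

/-- Labels of the pairs (hash function, sign function) used by a recursive sketch with `2 ^ q`
modes: one pair per mode for the CountSketches, and two pairs (`false` the first, `true` the
second) for the `n`-th TensorSketch in the layer with `2 ^ d` of them, `d < q`. -/
abbrev HashIndex (q : ℕ) : Type :=
  Fin (2 ^ q) ⊕ ((d : Fin q) × Fin (2 ^ (d : ℕ))) × Bool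

/-- Size of the domain of the functions with a given label. -/
abbrev hashDim (J : ℕ) {q : ℕ} (I : Fin (2 ^ q) → ℕ) : HashIndex q → ℕ :=
  Sum.elim I (fun _ => J)

/-- The recursive sketch `T⁽ᵠ⁾ ⋯ T⁽¹⁾ (⨂ₙ Cₙ)` with `2 ^ q` modes of sizes `I n`, for given hash
and sign functions. -/
def recursiveSketchPow {J q : ℕ} (I : Fin (2 ^ q) → ℕ)
    (h : ∀ a : HashIndex q, Fin (hashDim J I a) → Fin J)
    (s : ∀ a : HashIndex q, Fin (hashDim J I a) → ℤˣ) :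
    Matrix (Fin J) (∀ n, Fin (I n)) ℝ :=
  tensorTree q (fun d n => tensorSketch
      (h (Sum.inr (⟨d, n⟩, false))) (h (Sum.inr (⟨d, n⟩, true)))
      (s (Sum.inr (⟨d, n⟩, false))) (s (Sum.inr (⟨d, n⟩, true)))) *
    kronCount (fun n => countSketch (h (Sum.inl n)) (s (Sum.inl n)))

/-- The mode sizes padded to the length `2 ^ ⌈log₂ N⌉` with the largest mode size. -/
def paddedDim {N : ℕ} (I : Fin N → ℕ) : Fin (2 ^ Nat.clog 2 N) → ℕ :=
  fun n => if hn : (n : ℕ) < N then I ⟨n, hn⟩ else Finset.univ.sup I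

/-- The matrix of the linear map `x ↦ x ⊗ e₁ ⊗ ⋯ ⊗ e₁` with `2 ^ ⌈log₂ N⌉ - N` factors `e₁`
(first canonical basis vector). -/
def padMatrix {N : ℕ} (I : Fin N → ℕ) :
    Matrix (∀ n, Fin (paddedDim I n)) (∀ j, Fin (I j)) ℝ :=
  Matrix.of fun c i => ∏ n : Fin (2 ^ Nat.clog 2 N),
    if (c n : ℕ) = (if hn : (n : ℕ) < N then (i ⟨n, hn⟩ : ℕ) else 0) then 1 else 0

/-- The random matrix `Ψ` on the probability space `(Ω, μ)` is a `(J, (I_j))`-recursive sketch: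
it is built from mutually independent random functions, the hash functions being 3-wise and the
sign functions 4-wise independent. (All functions are mutually independent: the pairs are, and
so are the two members of each pair.) -/
def IsRecursiveSketch {Ω : Type*} [MeasurableSpace Ω] (μ : Measure Ω) {J N : ℕ} (I : Fin N → ℕ)
    (Ψ : Ω → Matrix (Fin J) (∀ j, Fin (I j)) ℝ) : Prop :=
  ∃ (h : ∀ a : HashIndex (Nat.clog 2 N), Ω → Fin (hashDim J (paddedDim I) a) → Fin J)
    (s : ∀ a : HashIndex (Nat.clog 2 N), Ω → Fin (hashDim J (paddedDim I) a) → ℤˣ),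
    (∀ a, KWiseIndependent 3 (h a) μ) ∧
    (∀ a, KWiseIndependent 4 (s a) μ) ∧
    (∀ a, IndepFun (h a) (s a) μ) ∧
    iIndepFun (fun a ω => (h a ω, s a ω)) μ ∧
    ∀ ω, Ψ ω = recursiveSketchPow (paddedDim I) (fun a => h a ω) (fun a => s a ω) * padMatrix I

/-- `Ψ` is a `γ`-subspace embedding for `A`:
`|‖Ψ A x‖₂² - ‖A x‖₂²| ≤ γ ‖A x‖₂²` for all `x`. -/
def IsSubspaceEmbedding {m n r : Type*} [Fintype m] [Fintype n] [Fintype r] (γ : ℝ)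
    (Ψ : Matrix m n ℝ) (A : Matrix n r ℝ) : Prop :=
  ∀ x : r → ℝ,
    |‖(WithLp.toLp 2 ((Ψ * A).mulVec x) : EuclideanSpace ℝ m)‖ ^ 2 -
        ‖(WithLp.toLp 2 (A.mulVec x) : EuclideanSpace ℝ n)‖ ^ 2| ≤
      γ * ‖(WithLp.toLp 2 (A.mulVec x) : EuclideanSpace ℝ n)‖ ^ 2

/-!
Call a random matrix `M` good with constant `c` if, for every fixed vector `x`,
`𝔼 ‖M x‖² = ‖x‖²` and `𝔼 ‖M x‖⁴ ≤ c ‖x‖⁴`.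

Goodness is multiplicative. For a product `A B` of independent matrices this follows by conditioning
on `B`. For a Kronecker product one writes `A ⊗ B = (A ⊗ I) (I ⊗ B)`; tensoring with an identity
does not change the constant, because `(∑ uₖ)² ≤ (∑ aₖ) (∑ uₖ² / aₖ)` with `uₖ = ‖A zₖ‖²` and
`aₖ = ‖zₖ‖²` (`MomentBound.fourth_family`, `MomentBound.mul`, `MomentBound.kronecker`).

A CountSketch and a degree-two TensorSketch are both good with constant `1 + 9 / J`. Both are matrices
with one random sign in a random row of each column (`signedHash_moments`). In the expansion of
`𝔼 (‖S x‖² - ‖x‖²)²` a collision of two columns has probability at most `1 / J`, and the mixed fourth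
moments of the signs are supported on index quadruples that can be paired off, separately in each of
the two modes for a TensorSketch. The Cauchy–Schwarz inequality bounds the resulting sum, with three
pairings for each mode (`sum_pairings_mul_pairings_abs_le`).

The recursive sketch has fewer than `2 ^ (q + 1) ≤ 4 N` such factors, so it is good with constant
`(1 + 9 / J) ^ (4 N) ≤ 1 + 72 N / J` when `J ≥ 36 N`. By polarization, the error on the inner product
of any two vectors of an orthonormal basis of the column space of `A` has second moment at most
`144 N / J`. The sum of the squares of these at most `R²` errors is below `γ²` with probability at
least `1 - δ` by Markov's inequality, and then the sketch is a `γ`-subspace embedding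
(`measureReal_isSubspaceEmbedding_ge`).

Independence is handled on the finite space of configurations of all hash and sign functions: a
matrix records the set of labels it depends on, and matrices with disjoint label sets are independent
(`integral_diag_eq_integral_integral`).
-/

open scoped Matrix Kronecker

/-! ### Squared Euclidean length -/

/-- The squared Euclidean length `‖v‖₂²` of a vector of real numbers, written as a finite sum so
that no norm has to be put on `n → ℝ`. -/
def sqLen {n : Type*} [Fintype n] (v : n → ℝ) : ℝ := ∑ i, v i ^ 2

lemma sqLen_nonneg {n : Type*} [Fintype n] (v : n → ℝ) : 0 ≤ sqLen v :=
  Finset.sum_nonneg fun _ _ => sq_nonneg _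

lemma sqLen_eq_norm_sq {n : Type*} [Fintype n] (v : n → ℝ) :
    sqLen v = ‖(WithLp.toLp 2 v : EuclideanSpace ℝ n)‖ ^ 2 := by
  simp [EuclideanSpace.real_norm_sq_eq, sqLen]

lemma sqLen_comp_equiv {n n' : Type*} [Fintype n] [Fintype n'] (v : n → ℝ) (e : n' ≃ n) :
    sqLen (v ∘ e) = sqLen v :=
  Equiv.sum_comp e fun i => v i ^ 2

lemma sqLen_prod {m n : Type*} [Fintype m] [Fintype n] (v : m × n → ℝ) :
    sqLen v = ∑ k, sqLen fun i => v (i, k) := by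
  simp only [sqLen]
  rw [Fintype.sum_prod_type, Finset.sum_comm]

lemma sqLen_prod' {m n : Type*} [Fintype m] [Fintype n] (v : m × n → ℝ) :
    sqLen v = ∑ i, sqLen fun k => v (i, k) := by
  simp only [sqLen]
  rw [Fintype.sum_prod_type]

/-! ### Independence on a finite space of configurations -/

/-- A statistic of finitely many values is integrable under a finite measure. -/
lemma integrable_comp_of_finite {Ω α : Type*} [MeasurableSpace Ω] [MeasurableSpace α] [Finite α]
    [MeasurableSingletonClass α] {μ : Measure Ω} [IsFiniteMeasure μ] {X : Ω → α}
    (hX : Measurable X) (f : α → ℝ) : Integrable (fun ω => f (X ω)) μ :=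
  (integrable_map_measure (Measurable.of_discrete (f := f)).aestronglyMeasurable
    hX.aemeasurable).1 Integrable.of_finite

/-- Fubini's theorem for two independent random variables with finitely many values. -/
lemma integral_indepFun {Ω α β : Type*} [MeasurableSpace Ω] [MeasurableSpace α] [Finite α]
    [MeasurableSingletonClass α] [MeasurableSpace β] [Finite β] [MeasurableSingletonClass β]
    {μ : Measure Ω} [IsProbabilityMeasure μ] {X : Ω → α} {Y : Ω → β} (hX : Measurable X)
    (hY : Measurable Y) (h : IndepFun X Y μ) (φ : α → β → ℝ) :
    ∫ ω, φ (X ω) (Y ω) ∂μ = ∫ ω', ∫ ω, φ (X ω) (Y ω') ∂μ ∂μ := by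
  have hmap := (indepFun_iff_map_prod_eq_prod_map_map hX.aemeasurable hY.aemeasurable).1 h
  have := Measure.isProbabilityMeasure_map (μ := μ) hX.aemeasurable
  have := Measure.isProbabilityMeasure_map (μ := μ) hY.aemeasurable
  calc ∫ ω, φ (X ω) (Y ω) ∂μ
      = ∫ p, φ p.1 p.2 ∂(μ.map fun ω => (X ω, Y ω)) := by
        rw [integral_map (hX.prodMk hY).aemeasurable
          (Measurable.of_discrete (f := fun p : α × β => φ p.1 p.2)).aestronglyMeasurable]
    _ = ∫ b, ∫ a, φ a b ∂(μ.map X) ∂(μ.map Y) := by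
        rw [hmap]
        exact integral_prod_symm _ Integrable.of_finite
    _ = ∫ ω', ∫ a, φ a (Y ω') ∂(μ.map X) ∂μ := by
        rw [integral_map hY.aemeasurable
          (Measurable.of_discrete (f := fun b => ∫ a, φ a b ∂(μ.map X))).aestronglyMeasurable]
    _ = _ := by
        congr 1 with ω'
        exact integral_map hX.aemeasurable
          (Measurable.of_discrete (f := fun a => φ a (Y ω'))).aestronglyMeasurable

lemma integral_mul_indepFun {Ω α β : Type*} [MeasurableSpace Ω] [MeasurableSpace α] [Finite α]
    [MeasurableSingletonClass α] [MeasurableSpace β] [Finite β] [MeasurableSingletonClass β]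
    {μ : Measure Ω} [IsProbabilityMeasure μ] {X : Ω → α} {Y : Ω → β} (hX : Measurable X)
    (hY : Measurable Y) (h : IndepFun X Y μ) (f : α → ℝ) (g : β → ℝ) :
    ∫ ω, f (X ω) * g (Y ω) ∂μ = (∫ ω, f (X ω) ∂μ) * ∫ ω, g (Y ω) ∂μ := by
  rw [integral_indepFun hX hY h fun a b => f a * g b]
  simp only [integral_mul_const, integral_const_mul]

section Config

variable {ι : Type*} [Fintype ι] {E : ι → Type*} [∀ a, Finite (E a)] [∀ a, MeasurableSpace (E a)]
  [∀ a, MeasurableSingletonClass (E a)] {P : Measure (∀ a, E a)} [IsProbabilityMeasure P]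

/-- If a function of two configurations looks at the first one only through the labels in `S` and at
the second one only through labels outside `S`, then its mean on the diagonal is the mean over two
independent configurations. -/
lemma integral_diag_eq_integral_integral (hP : iIndepFun (fun a (e : ∀ a, E a) => e a) P)
    {S T : Set ι} (hST : Disjoint S T) {φ : (∀ a, E a) → (∀ a, E a) → ℝ}
    (h1 : ∀ e', DependsOn (fun e => φ e e') S) (h2 : ∀ e, DependsOn (φ e) T) :
    ∫ e, φ e e ∂P = ∫ e', ∫ e, φ e e' ∂P ∂P := by
  classical
  obtain ⟨e₀⟩ : Nonempty (∀ a, E a) := nonempty_of_isProbabilityMeasure P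
  have hind := hP.indepFun_finset S.toFinset T.toFinset (by simpa using hST)
    (fun a => measurable_pi_apply a)
  let r (A : Finset ι) (e : ∀ a, E a) (i : A) : E i := e i
  let ext (A : Finset ι) (x : ∀ i : A, E i) (a : ι) : E a :=
    if h : a ∈ A then x ⟨a, h⟩ else e₀ a
  have key : ∀ e e', φ e e' = φ (ext S.toFinset (r _ e)) (ext T.toFinset (r _ e')) := by
    intro e e'
    have e1 : φ e e' = φ (ext S.toFinset (r _ e)) e' := by
      refine h1 e' fun i hi => ?_
      simp [ext, r, hi]
    rw [e1]
    refine h2 _ fun i hi => ?_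
    simp [ext, r, hi]
  have hr (A : Finset ι) : Measurable (r A) := .of_discrete
  have := integral_indepFun (hr _) (hr _) hind
    (fun x y => φ (ext S.toFinset x) (ext T.toFinset y))
  simp only [← key] at this
  exact this

/-! ### Random matrices with controlled second and fourth moments -/

/-- The random matrix `M`, a function of a random configuration with law `P`, uses only the
labels in `S`, preserves squared lengths in the mean, and satisfies
`𝔼 ‖M x‖⁴ ≤ c ‖x‖⁴`. -/
structure MomentBound (P : Measure (∀ a, E a)) {m n : Type*} [Fintype m] [Fintype n]
    (S : Set ι) (M : (∀ a, E a) → Matrix m n ℝ) (c : ℝ) : Prop where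
  dependsOn : DependsOn M S
  second : ∀ x, ∫ e, sqLen (M e *ᵥ x) ∂P = sqLen x
  fourth : ∀ x, ∫ e, sqLen (M e *ᵥ x) ^ 2 ∂P ≤ c * sqLen x ^ 2

namespace MomentBound

variable {m n m' n' : Type*} [Fintype m] [Fintype n] [Fintype m'] [Fintype n']
  {S T : Set ι} {M : (∀ a, E a) → Matrix m n ℝ} {c c' : ℝ}

omit [Fintype ι] [∀ a, Finite (E a)] [∀ a, MeasurableSingletonClass (E a)]
  [IsProbabilityMeasure P] in
lemma mono (h : MomentBound P S M c) (hST : S ⊆ T) (hc : c ≤ c') : MomentBound P T M c' :=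
  ⟨h.dependsOn.mono hST, h.second, fun x =>
    (h.fourth x).trans (mul_le_mul_of_nonneg_right hc (sq_nonneg _))⟩

lemma second_family (h : MomentBound P S M c) {κ : Type*} [Fintype κ] (z : κ → n → ℝ) :
    ∫ e, ∑ k, sqLen (M e *ᵥ z k) ∂P = ∑ k, sqLen (z k) := by
  rw [integral_finsetSum _ fun _ _ => Integrable.of_finite]
  simp only [h.second]

/-- The fourth-moment bound passes to `I ⊗ M` with the same constant: by Sedrakyan's form of the
Cauchy–Schwarz inequality, `(∑ uₖ)² ≤ (∑ aₖ) (∑ uₖ² / aₖ)` for `uₖ = ‖M zₖ‖²` and `aₖ = ‖zₖ‖²`,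
and the mean of `uₖ² / aₖ` is at most `c aₖ`. -/
lemma fourth_family (h : MomentBound P S M c) {κ : Type*} [Fintype κ] (z : κ → n → ℝ) :
    ∫ e, (∑ k, sqLen (M e *ᵥ z k)) ^ 2 ∂P ≤ c * (∑ k, sqLen (z k)) ^ 2 := by
  have pt : ∀ e, (∑ k, sqLen (M e *ᵥ z k)) ^ 2 ≤
      (∑ k, sqLen (z k)) * ∑ k, sqLen (M e *ᵥ z k) ^ 2 / sqLen (z k) := by
    intro e
    refine Finset.sum_sq_le_sum_mul_sum_of_sq_le_mul _ (fun k _ => sqLen_nonneg _)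
      (fun k _ => div_nonneg (sq_nonneg _) (sqLen_nonneg _)) fun k _ => ?_
    rcases eq_or_ne (sqLen (z k)) 0 with h0 | h0
    · -- division by zero is harmless: `z k = 0`, so the left-hand side vanishes too
      have hz : z k = 0 := by
        funext i
        have := (Finset.sum_eq_zero_iff_of_nonneg fun i _ => sq_nonneg (z k i)).1 h0 i
          (Finset.mem_univ i)
        simpa using this
      simp [hz, sqLen]
    · rw [mul_div_cancel₀ _ h0]
  calc ∫ e, (∑ k, sqLen (M e *ᵥ z k)) ^ 2 ∂P
      ≤ ∫ e, (∑ k, sqLen (z k)) * ∑ k, sqLen (M e *ᵥ z k) ^ 2 / sqLen (z k) ∂P :=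
        integral_mono Integrable.of_finite Integrable.of_finite pt
    _ = (∑ k, sqLen (z k)) * ∑ k, (∫ e, sqLen (M e *ᵥ z k) ^ 2 ∂P) / sqLen (z k) := by
        rw [integral_const_mul, integral_finsetSum _ fun _ _ => Integrable.of_finite]
        simp only [integral_div]
    _ ≤ (∑ k, sqLen (z k)) * ∑ k, c * sqLen (z k) := by
        refine mul_le_mul_of_nonneg_left (Finset.sum_le_sum fun k _ => ?_)
          (Finset.sum_nonneg fun _ _ => sqLen_nonneg _)
        rcases (sqLen_nonneg (z k)).eq_or_lt with h0 | h0
        · rw [← h0]; simp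
        · rw [div_le_iff₀ h0]
          exact (h.fourth _).trans_eq (by ring)
    _ = _ := by rw [← Finset.mul_sum]; ring

lemma mul (hP : iIndepFun (fun a (e : ∀ a, E a) => e a) P) {k : Type*} [Fintype k]
    {A : (∀ a, E a) → Matrix k m ℝ} {B : (∀ a, E a) → Matrix m n ℝ}
    (hA : MomentBound P S A c) (hB : MomentBound P T B c') (hST : Disjoint S T) (hc : 0 ≤ c) :
    MomentBound P (S ∪ T) (fun e => A e * B e) (c * c') := by
  have hφ (g : ℝ → ℝ) (x : n → ℝ) : ∫ e, g (sqLen ((A e * B e) *ᵥ x)) ∂P =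
      ∫ e', ∫ e, g (sqLen (A e *ᵥ (B e' *ᵥ x))) ∂P ∂P := by
    simp only [← Matrix.mulVec_mulVec]
    refine integral_diag_eq_integral_integral hP hST
      (φ := fun e e' => g (sqLen (A e *ᵥ (B e' *ᵥ x))))
      (fun e' e₁ e₂ he => ?_) (fun e e₁ e₂ he => ?_)
    · simp only [hA.dependsOn he]
    · simp only [hB.dependsOn he]
  refine ⟨fun e₁ e₂ he => ?_, fun x => ?_, fun x => ?_⟩
  · simp only [hA.dependsOn fun i hi => he i (Or.inl hi),
      hB.dependsOn fun i hi => he i (Or.inr hi)]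
  · refine (hφ id x).trans ?_
    simp only [id, hA.second, hB.second]
  · calc ∫ e, sqLen ((A e * B e) *ᵥ x) ^ 2 ∂P
        = ∫ e', ∫ e, sqLen (A e *ᵥ (B e' *ᵥ x)) ^ 2 ∂P ∂P := hφ (· ^ 2) x
      _ ≤ ∫ e', c * sqLen (B e' *ᵥ x) ^ 2 ∂P :=
        integral_mono Integrable.of_finite Integrable.of_finite fun e' => hA.fourth _
      _ = c * ∫ e', sqLen (B e' *ᵥ x) ^ 2 ∂P := integral_const_mul _ _
      _ ≤ c * (c' * sqLen x ^ 2) := mul_le_mul_of_nonneg_left (hB.fourth x) hc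
      _ = _ := by ring

omit [Fintype ι] [∀ a, Finite (E a)] [∀ a, MeasurableSingletonClass (E a)]
  [IsProbabilityMeasure P] in
lemma submatrix (h : MomentBound P S M c) (f : m' ≃ m) (g : n' ≃ n) :
    MomentBound P S (fun e => (M e).submatrix f g) c := by
  have key : ∀ e x, sqLen ((M e).submatrix f g *ᵥ x) = sqLen (M e *ᵥ (x ∘ g.symm)) := by
    intro e x
    rw [Matrix.submatrix_mulVec_equiv, sqLen_comp_equiv]
  refine ⟨fun e₁ e₂ he => ?_, fun x => ?_, fun x => ?_⟩
  · simp only [h.dependsOn he]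
  · simp only [key, h.second, sqLen_comp_equiv]
  · simp only [key]
    simpa only [sqLen_comp_equiv] using h.fourth (x ∘ g.symm)

lemma kronecker (hP : iIndepFun (fun a (e : ∀ a, E a) => e a) P)
    {A : (∀ a, E a) → Matrix m n ℝ} {B : (∀ a, E a) → Matrix m' n' ℝ}
    (hA : MomentBound P S A c) (hB : MomentBound P T B c') (hST : Disjoint S T) (hc : 0 ≤ c) :
    MomentBound P (S ∪ T) (fun e => A e ⊗ₖ B e) (c * c') := by
  -- first apply `B` to the rows of `x`, then `A` to the columns of the result
  let y (x : n × n' → ℝ) (e' : ∀ a, E a) (i : m') (j : n) : ℝ := (B e' *ᵥ fun j' => x (j, j')) i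
  have key : ∀ e x, sqLen ((A e ⊗ₖ B e) *ᵥ x) = ∑ i, sqLen (A e *ᵥ y x e i) := by
    intro e x
    rw [sqLen_prod]
    refine Finset.sum_congr rfl fun i' _ => ?_
    congr 1 with i
    simp only [Matrix.mulVec, dotProduct, y, Matrix.kroneckerMap_apply, Fintype.sum_prod_type,
      Finset.mul_sum, mul_assoc]
  have hy : ∀ e' x, ∑ i, sqLen (y x e' i) = ∑ j, sqLen (B e' *ᵥ fun j' => x (j, j')) := by
    intro e' x
    simp only [sqLen, y]
    exact Finset.sum_comm
  have hφ (g : ℝ → ℝ) (x : n × n' → ℝ) : ∫ e, g (sqLen ((A e ⊗ₖ B e) *ᵥ x)) ∂P =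
      ∫ e', ∫ e, g (∑ i, sqLen (A e *ᵥ y x e' i)) ∂P ∂P := by
    simp only [key]
    refine integral_diag_eq_integral_integral hP hST
      (φ := fun e e' => g (∑ i, sqLen (A e *ᵥ y x e' i)))
      (fun e' e₁ e₂ he => ?_) (fun e e₁ e₂ he => ?_)
    · simp only [hA.dependsOn he]
    · simp only [y, hB.dependsOn he]
  refine ⟨fun e₁ e₂ he => ?_, fun x => ?_, fun x => ?_⟩
  · simp only [hA.dependsOn fun i hi => he i (Or.inl hi),
      hB.dependsOn fun i hi => he i (Or.inr hi)]
  · refine (hφ id x).trans ?_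
    simp only [id, hA.second_family, hy, hB.second_family]
    exact (sqLen_prod' x).symm
  · calc ∫ e, sqLen ((A e ⊗ₖ B e) *ᵥ x) ^ 2 ∂P
        = ∫ e', ∫ e, (∑ i, sqLen (A e *ᵥ y x e' i)) ^ 2 ∂P ∂P := hφ (· ^ 2) x
      _ ≤ ∫ e', c * (∑ j, sqLen (B e' *ᵥ fun j' => x (j, j'))) ^ 2 ∂P :=
        integral_mono Integrable.of_finite Integrable.of_finite fun e' => by
          simpa only [hy] using hA.fourth_family (y x e')
      _ = c * ∫ e', (∑ j, sqLen (B e' *ᵥ fun j' => x (j, j'))) ^ 2 ∂P := integral_const_mul _ _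
      _ ≤ c * (c' * (∑ j, sqLen fun j' => x (j, j')) ^ 2) :=
        mul_le_mul_of_nonneg_left (hB.fourth_family _) hc
      _ = _ := by rw [← sqLen_prod' x]; ring

/-- Kronecker products of arbitrarily many independent factors, indexed by multi-indices. -/
lemma pi (hP : iIndepFun (fun a (e : ∀ a, E a) => e a) P) (hc : 0 ≤ c) :
    ∀ {K : ℕ} {α β : Fin K → Type} [∀ k, Fintype (α k)] [∀ k, Fintype (β k)] (S : Fin K → Set ι)
      (M : ∀ k, (∀ a, E a) → Matrix (α k) (β k) ℝ),
      Pairwise (fun k l => Disjoint (S k) (S l)) → (∀ k, MomentBound P (S k) (M k) c) →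
      MomentBound P (⋃ k, S k)
        (fun e => (Matrix.of fun r s => ∏ k, M k e (r k) (s k) :
          Matrix (∀ k, α k) (∀ k, β k) ℝ)) (c ^ K)
  | 0, α, β, _, _, S, M, _, _ => by
    have key : ∀ x : (∀ k, β k) → ℝ, sqLen ((Matrix.of fun _ _ => 1 :
        Matrix (∀ k, α k) (∀ k, β k) ℝ) *ᵥ x) = sqLen x := by
      intro x
      simp [sqLen, Matrix.mulVec, dotProduct]
    refine ⟨fun _ _ _ => by simp, fun x => ?_, fun x => ?_⟩
    · simp [key]
    · simp [key]
  | K + 1, α, β, _, _, S, M, hS, hM => by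
    have ih := pi hP hc (fun k => S k.succ) (fun k => M k.succ)
      (fun k l hkl => hS (by simpa using hkl)) (fun k => hM k.succ)
    have hdisj : Disjoint (S 0) (⋃ k : Fin K, S k.succ) := by
      rw [Set.disjoint_iUnion_right]
      exact fun k => hS (Fin.succ_ne_zero k).symm
    have h := ((hM 0).kronecker hP ih hdisj hc).submatrix (Fin.consEquiv α).symm
      (Fin.consEquiv β).symm
    have hset : S 0 ∪ ⋃ k : Fin K, S k.succ = ⋃ k, S k := by
      ext a
      simp [Fin.exists_fin_succ]
    rw [hset] at h
    convert h using 1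
    · funext e
      ext r s
      simp [Fin.prod_univ_succ, Matrix.kroneckerMap_apply, Fin.consEquiv, Fin.tail]
    · ring

end MomentBound

end Config

/-! ### Pairings of four indices -/

/-- The number of ways in which the positions of `a, b, c, d` can be paired so that paired entries
coincide. It dominates the mixed moment `𝔼 s(a) s(b) s(c) s(d)` of 4-wise independent signs. -/
def pairings {n : Type*} [DecidableEq n] (a b c d : n) : ℝ :=
  (if a = b then 1 else 0) * (if c = d then 1 else 0) +
    (if a = c then 1 else 0) * (if b = d then 1 else 0) +
    (if a = d then 1 else 0) * (if b = c then 1 else 0)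

lemma pairings_nonneg {n : Type*} [DecidableEq n] (a b c d : n) : 0 ≤ pairings a b c d := by
  unfold pairings
  positivity

/-- Each of the three pairings turns the sum into a product of two inner products. -/
lemma sum_pairings {n : Type*} [Fintype n] [DecidableEq n] (f g h k : n → ℝ) :
    ∑ a, ∑ b, ∑ c, ∑ d, pairings a b c d * (f a * g b * h c * k d) =
      (∑ i, f i * g i) * (∑ i, h i * k i) + (∑ i, f i * h i) * (∑ i, g i * k i) +
        (∑ i, f i * k i) * (∑ i, g i * h i) := by
  have h1 : ∀ a b c, ∑ d, pairings a b c d * (f a * g b * h c * k d) =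
      (if a = b then f a * g b * (h c * k c) else 0) +
      (if a = c then f a * h c * (g b * k b) else 0) +
      (if b = c then f a * k a * (g b * h c) else 0) := by
    intro a b c
    have : ∀ d, pairings a b c d * (f a * g b * h c * k d) =
        (if c = d then (if a = b then f a * g b * (h c * k d) else 0) else 0) +
        (if b = d then (if a = c then f a * h c * (g b * k d) else 0) else 0) +
        (if a = d then (if b = c then f a * k d * (g b * h c) else 0) else 0) := by
      intro d
      simp only [pairings, add_mul]
      congr 1
      · congr 1 <;> split_ifs <;> ring
      · split_ifs <;> ring
    simp [this, Finset.sum_add_distrib]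
  have h2 : ∀ a b, ∑ c, ∑ d, pairings a b c d * (f a * g b * h c * k d) =
      (if a = b then f a * g b * ∑ c, h c * k c else 0) +
      f a * h a * (g b * k b) + f a * k a * (g b * h b) := by
    intro a b
    simp only [h1, Finset.sum_add_distrib, Finset.sum_ite_eq, Finset.mem_univ, if_true]
    split_ifs
    · rw [Finset.mul_sum]
    · simp
  simp only [h2, Finset.sum_add_distrib, Finset.sum_ite_eq, Finset.mem_univ, if_true,
    ← Finset.mul_sum, ← Finset.sum_mul]

lemma sum_quadruple {A : Type*} [Fintype A] (F : A → A → A → A → ℝ) :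
    ∑ t : (A × A) × (A × A), F t.1.1 t.1.2 t.2.1 t.2.2 = ∑ a, ∑ b, ∑ c, ∑ d, F a b c d := by
  simp only [Fintype.sum_prod_type]

lemma sum_mul_le_sqrt_mul_sqrt {n : Type*} [Fintype n] (f g : n → ℝ) :
    ∑ i, f i * g i ≤ √(sqLen f) * √(sqLen g) :=
  Real.sum_mul_le_sqrt_mul_sqrt _ f g

lemma sum_pairings_le {n : Type*} [Fintype n] [DecidableEq n] {f g h k : n → ℝ}
    (hg : ∀ i, 0 ≤ g i) (hh : ∀ i, 0 ≤ h i) (hk : ∀ i, 0 ≤ k i) :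
    ∑ a, ∑ b, ∑ c, ∑ d, pairings a b c d * (f a * g b * h c * k d) ≤
      3 * (√(sqLen f) * √(sqLen g) * √(sqLen h) * √(sqLen k)) := by
  rw [sum_pairings]
  have key : ∀ {p q r s : n → ℝ}, (∀ i, 0 ≤ r i) → (∀ i, 0 ≤ s i) →
      (∑ i, p i * q i) * (∑ i, r i * s i) ≤
        (√(sqLen p) * √(sqLen q)) * (√(sqLen r) * √(sqLen s)) := fun hr hs =>
    mul_le_mul (sum_mul_le_sqrt_mul_sqrt _ _) (sum_mul_le_sqrt_mul_sqrt _ _)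
      (Finset.sum_nonneg fun i _ => mul_nonneg (hr i) (hs i)) (by positivity)
  linarith [key (p := f) (q := g) hh hk, key (p := f) (q := h) hg hk, key (p := f) (q := k) hg hh]

lemma sum_pairings_abs_le {n : Type*} [Fintype n] [DecidableEq n] (x : n → ℝ) :
    ∑ a, ∑ b, ∑ c, ∑ d, pairings a b c d * |x a * x b * x c * x d| ≤ 3 * sqLen x ^ 2 := by
  have h := sum_pairings_le (f := fun i => |x i|) (g := fun i => |x i|) (h := fun i => |x i|)
    (k := fun i => |x i|) (fun _ => abs_nonneg _) (fun _ => abs_nonneg _)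
    (fun _ => abs_nonneg _)
  have e : sqLen (fun i => |x i|) = sqLen x := by simp [sqLen]
  have e2 : √(sqLen x) * √(sqLen x) * √(sqLen x) * √(sqLen x) = sqLen x ^ 2 := by
    have := Real.mul_self_sqrt (sqLen_nonneg x)
    rw [this, mul_assoc, this, sq]
  rw [e, e2] at h
  simpa only [abs_mul] using h

/-- The bound for pairs of indices follows from the one for single indices, applied to the rows of
the matrix `x` and then to the vector of the lengths of its rows. -/
lemma sum_pairings_mul_pairings_abs_le {n n' : Type*} [Fintype n] [DecidableEq n] [Fintype n']
    [DecidableEq n'] (x : n × n' → ℝ) :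
    ∑ a, ∑ b, ∑ c, ∑ d, (pairings a.1 b.1 c.1 d.1 * pairings a.2 b.2 c.2 d.2) *
      |x a * x b * x c * x d| ≤ 9 * sqLen x ^ 2 := by
  let y (i : n) (k : n') : ℝ := |x (i, k)|
  let ρ (i : n) : ℝ := √(sqLen (y i))
  have hρ : sqLen ρ = sqLen x := by
    rw [sqLen_prod' x]
    refine Finset.sum_congr rfl fun i _ => ?_
    rw [Real.sq_sqrt (sqLen_nonneg _)]
    simp [sqLen, y]
  let F (a b c d : n × n') : ℝ := (pairings a.1 b.1 c.1 d.1 * pairings a.2 b.2 c.2 d.2) *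
      |x a * x b * x c * x d|
  -- separate the first from the second coordinates of the four indices
  let ψ : ((n × n') × (n × n')) × ((n × n') × (n × n')) ≃
      ((n × n) × (n × n)) × ((n' × n') × (n' × n')) :=
    { toFun := fun t => (((t.1.1.1, t.1.2.1), (t.2.1.1, t.2.2.1)),
        ((t.1.1.2, t.1.2.2), (t.2.1.2, t.2.2.2)))
      invFun := fun t => (((t.1.1.1, t.2.1.1), (t.1.1.2, t.2.1.2)),
        ((t.1.2.1, t.2.2.1), (t.1.2.2, t.2.2.2)))
      left_inv := fun _ => rfl
      right_inv := fun _ => rfl }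
  have reorder : ∑ a, ∑ b, ∑ c, ∑ d, F a b c d =
      ∑ a, ∑ b, ∑ c, ∑ d, ∑ a', ∑ b', ∑ c', ∑ d', F (a, a') (b, b') (c, c') (d, d') := by
    calc ∑ a, ∑ b, ∑ c, ∑ d, F a b c d
        = ∑ t : ((n × n') × (n × n')) × ((n × n') × (n × n')),
            F t.1.1 t.1.2 t.2.1 t.2.2 := (sum_quadruple F).symm
      _ = ∑ t : ((n × n) × (n × n)) × ((n' × n') × (n' × n')),
            F (t.1.1.1, t.2.1.1) (t.1.1.2, t.2.1.2) (t.1.2.1, t.2.2.1) (t.1.2.2, t.2.2.2) :=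
          Fintype.sum_equiv ψ _ _ fun _ => rfl
      _ = ∑ p : (n × n) × (n × n), ∑ a', ∑ b', ∑ c', ∑ d',
            F (p.1.1, a') (p.1.2, b') (p.2.1, c') (p.2.2, d') := by
          rw [Fintype.sum_prod_type]
          exact Finset.sum_congr rfl fun p _ => sum_quadruple fun a' b' c' d' =>
            F (p.1.1, a') (p.1.2, b') (p.2.1, c') (p.2.2, d')
      _ = _ := sum_quadruple fun a b c d => ∑ a', ∑ b', ∑ c', ∑ d',
            F (a, a') (b, b') (c, c') (d, d')
  have inner : ∀ a b c d, ∑ a', ∑ b', ∑ c', ∑ d', F (a, a') (b, b') (c, c') (d, d') ≤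
      3 * (pairings a b c d * (ρ a * ρ b * ρ c * ρ d)) := by
    intro a b c d
    have := mul_le_mul_of_nonneg_left (sum_pairings_le (f := y a) (g := y b) (h := y c) (k := y d)
      (fun _ => abs_nonneg _) (fun _ => abs_nonneg _) (fun _ => abs_nonneg _)) (pairings_nonneg a b c d)
    refine le_of_eq_of_le ?_ (this.trans_eq (by ring))
    simp only [Finset.mul_sum, F, y, abs_mul, mul_assoc]
  calc ∑ a, ∑ b, ∑ c, ∑ d, F a b c d
      ≤ ∑ a, ∑ b, ∑ c, ∑ d, 3 * (pairings a b c d * (ρ a * ρ b * ρ c * ρ d)) := by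
        rw [reorder]
        exact Finset.sum_le_sum fun a _ => Finset.sum_le_sum fun b _ =>
          Finset.sum_le_sum fun c _ => Finset.sum_le_sum fun d _ => inner a b c d
    _ = 3 * ∑ a, ∑ b, ∑ c, ∑ d, pairings a b c d * |ρ a * ρ b * ρ c * ρ d| := by
        have : ∀ a b c d, |ρ a * ρ b * ρ c * ρ d| = ρ a * ρ b * ρ c * ρ d := fun a b c d =>
          abs_of_nonneg (by positivity)
        simp only [Finset.mul_sum, this]
    _ ≤ 9 * sqLen x ^ 2 := by
        have := sum_pairings_abs_le ρ
        rw [hρ] at this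
        linarith

/-! ### Signed hashing matrices -/

/-- A matrix with one entry `σ i` in each column `i`, in the row `η i`. -/
def signedHash {n : Type*} {J : ℕ} (η : n → Fin J) (σ : n → ℝ) : Matrix (Fin J) n ℝ :=
  Matrix.of fun j i => σ i * if η i = j then 1 else 0

lemma sqLen_signedHash_mulVec {n : Type*} [Fintype n] [DecidableEq n] {J : ℕ} (η : n → Fin J)
    {σ : n → ℝ} (hσ : ∀ i, σ i ^ 2 = 1) (x : n → ℝ) :
    sqLen (signedHash η σ *ᵥ x) = sqLen x + ∑ u ∈ (Finset.univ : Finset n).offDiag,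
      (σ u.1 * σ u.2 * if η u.1 = η u.2 then 1 else 0) * (x u.1 * x u.2) := by
  have h1 : sqLen (signedHash η σ *ᵥ x) = ∑ u : n × n,
      (σ u.1 * σ u.2 * if η u.1 = η u.2 then 1 else 0) * (x u.1 * x u.2) := by
    simp only [sqLen, Matrix.mulVec, dotProduct, signedHash, Matrix.of_apply, sq,
      Finset.sum_mul_sum, Fintype.sum_prod_type]
    rw [Finset.sum_comm]
    refine Finset.sum_congr rfl fun i _ => ?_
    rw [Finset.sum_comm]
    refine Finset.sum_congr rfl fun i' _ => ?_
    have : ∀ j, σ i * (if η i = j then 1 else 0) * x i * (σ i' * (if η i' = j then 1 else 0) * x i')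
        = if η i = j then (σ i * σ i' * if η i' = j then 1 else 0) * (x i * x i') else 0 := by
      intro j
      split_ifs <;> ring
    simp only [this, Finset.sum_ite_eq, Finset.mem_univ, if_true, @eq_comm _ (η i') (η i)]
  rw [h1, ← Finset.univ_product_univ, ← Finset.diag_union_offDiag,
    Finset.sum_union (Finset.disjoint_diag_offDiag _)]
  congr 1
  simp only [Finset.sum_diag, if_true, sqLen]
  refine Finset.sum_congr rfl fun i _ => ?_
  linear_combination x i ^ 2 * hσ i

/-- Second and fourth moments of a random signed hashing matrix, from the pair collisions of the
hash function and the mixed fourth moments of the sign function. With `Z = ‖S x‖² - ‖x‖²` one has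
`𝔼 Z = 0`, and in the expansion of `𝔼 Z²` a collision costs a factor `1 / J`. -/
lemma signedHash_moments {Ω α β n : Type*} [MeasurableSpace Ω] [MeasurableSpace α] [Finite α]
    [MeasurableSingletonClass α] [MeasurableSpace β] [Finite β] [MeasurableSingletonClass β]
    {μ : Measure Ω} [IsProbabilityMeasure μ] {X : Ω → α} {Y : Ω → β} (hX : Measurable X)
    (hY : Measurable Y) (h : IndepFun X Y μ) [Fintype n] [DecidableEq n] {J : ℕ}
    (η : α → n → Fin J) (σ : β → n → ℝ) (hσ : ∀ y i, σ y i ^ 2 = 1)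
    (hη : ∀ i i', i ≠ i' → ∫ ω, (if η (X ω) i = η (X ω) i' then 1 else 0 : ℝ) ∂μ ≤ 1 / J)
    (h2 : ∀ i i', i ≠ i' → ∫ ω, σ (Y ω) i * σ (Y ω) i' ∂μ = 0)
    {w : n → n → n → n → ℝ} (hw : ∀ a b c d, 0 ≤ w a b c d)
    (h4 : ∀ a b c d, |∫ ω, σ (Y ω) a * σ (Y ω) b * (σ (Y ω) c * σ (Y ω) d) ∂μ| ≤ w a b c d)
    {κ : ℝ} (hκ : ∀ x : n → ℝ,
      ∑ a, ∑ b, ∑ c, ∑ d, w a b c d * |x a * x b * x c * x d| ≤ κ * sqLen x ^ 2) (x : n → ℝ) :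
    ∫ ω, sqLen (signedHash (η (X ω)) (σ (Y ω)) *ᵥ x) ∂μ = sqLen x ∧
    ∫ ω, sqLen (signedHash (η (X ω)) (σ (Y ω)) *ᵥ x) ^ 2 ∂μ ≤ (1 + κ / J) * sqLen x ^ 2 := by
  let D := (Finset.univ : Finset n).offDiag
  let t (u : n × n) (ω : Ω) : ℝ :=
    σ (Y ω) u.1 * σ (Y ω) u.2 * if η (X ω) u.1 = η (X ω) u.2 then 1 else 0
  let Z (ω : Ω) : ℝ := ∑ u ∈ D, t u ω * (x u.1 * x u.2)
  have int (φ : α → β → ℝ) : Integrable (fun ω => φ (X ω) (Y ω)) μ :=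
    integrable_comp_of_finite (hX.prodMk hY) fun p : α × β => φ p.1 p.2
  have hS : ∀ ω, sqLen (signedHash (η (X ω)) (σ (Y ω)) *ᵥ x) = sqLen x + Z ω := fun ω =>
    sqLen_signedHash_mulVec _ (hσ _) x
  have it (u : n × n) (a : ℝ) : Integrable (fun ω => t u ω * a) μ :=
    int fun p q => σ q u.1 * σ q u.2 * (if η p u.1 = η p u.2 then 1 else 0) * a
  have itt (u v : n × n) (a : ℝ) : Integrable (fun ω => t u ω * t v ω * a) μ :=
    int fun p q => (σ q u.1 * σ q u.2 * if η p u.1 = η p u.2 then 1 else 0) *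
      (σ q v.1 * σ q v.2 * if η p v.1 = η p v.2 then 1 else 0) * a
  have iZ : Integrable Z μ := integrable_finsetSum _ fun u _ => it u _
  have hZ0 : ∫ ω, Z ω ∂μ = 0 := by
    simp only [Z]
    rw [integral_finsetSum _ fun u _ => it u _]
    refine Finset.sum_eq_zero fun u hu => ?_
    rw [integral_mul_const]
    have : ∫ ω, t u ω ∂μ = 0 := by
      simp only [t]
      rw [integral_mul_indepFun hY hX h.symm (fun q => σ q u.1 * σ q u.2)
        (fun p => if η p u.1 = η p u.2 then 1 else 0), h2 _ _ (Finset.mem_offDiag.1 hu).2.2,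
        zero_mul]
    rw [this, zero_mul]
  have hZ2eq : ∀ ω, Z ω ^ 2 = ∑ u ∈ D, ∑ v ∈ D,
      t u ω * t v ω * (x u.1 * x u.2 * x v.1 * x v.2) := by
    intro ω
    rw [sq]
    simp only [Z, Finset.sum_mul_sum]
    refine Finset.sum_congr rfl fun u _ => Finset.sum_congr rfl fun v _ => by ring
  have iZ2 : Integrable (fun ω => Z ω ^ 2) μ := by
    simp only [hZ2eq]
    exact integrable_finsetSum _ fun u _ => integrable_finsetSum _ fun v _ => itt u v _
  have htt : ∀ u ∈ D, ∀ v, |∫ ω, t u ω * t v ω ∂μ| ≤ w u.1 u.2 v.1 v.2 / J := by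
    intro u hu v
    have e : ∀ ω, t u ω * t v ω = σ (Y ω) u.1 * σ (Y ω) u.2 * (σ (Y ω) v.1 * σ (Y ω) v.2) *
        ((if η (X ω) u.1 = η (X ω) u.2 then 1 else 0) *
          if η (X ω) v.1 = η (X ω) v.2 then 1 else 0) := fun ω => by simp only [t]; ring
    simp only [e]
    rw [integral_mul_indepFun hY hX h.symm (fun q => σ q u.1 * σ q u.2 * (σ q v.1 * σ q v.2))
      (fun p => (if η p u.1 = η p u.2 then 1 else 0) * if η p v.1 = η p v.2 then 1 else 0),
      abs_mul, div_eq_mul_one_div]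
    refine mul_le_mul (h4 _ _ _ _) ?_ (abs_nonneg _) (hw _ _ _ _)
    rw [abs_of_nonneg (integral_nonneg fun ω => by positivity)]
    refine le_trans (integral_mono
      (int fun p _ => (if η p u.1 = η p u.2 then 1 else 0) * if η p v.1 = η p v.2 then 1 else 0)
      (int fun p _ => if η p u.1 = η p u.2 then 1 else 0) fun ω => ?_)
      (hη _ _ (Finset.mem_offDiag.1 hu).2.2)
    dsimp only
    split_ifs <;> norm_num
  have hZ2 : ∫ ω, Z ω ^ 2 ∂μ ≤ κ / J * sqLen x ^ 2 := by
    calc ∫ ω, Z ω ^ 2 ∂μ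
        = ∑ u ∈ D, ∑ v ∈ D, (∫ ω, t u ω * t v ω ∂μ) * (x u.1 * x u.2 * x v.1 * x v.2) := by
          simp only [hZ2eq]
          rw [integral_finsetSum _ fun u _ => integrable_finsetSum _ fun v _ => itt u v _]
          refine Finset.sum_congr rfl fun u _ => ?_
          rw [integral_finsetSum _ fun v _ => itt u v _]
          exact Finset.sum_congr rfl fun v _ => integral_mul_const _ _
      _ ≤ ∑ u ∈ D, ∑ v ∈ D, w u.1 u.2 v.1 v.2 / J * |x u.1 * x u.2 * x v.1 * x v.2| := by
          refine Finset.sum_le_sum fun u hu => Finset.sum_le_sum fun v _ => ?_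
          refine (le_abs_self _).trans ?_
          rw [abs_mul]
          exact mul_le_mul_of_nonneg_right (htt u hu v) (abs_nonneg _)
      _ ≤ ∑ u : n × n, ∑ v : n × n,
            w u.1 u.2 v.1 v.2 / J * |x u.1 * x u.2 * x v.1 * x v.2| := by
          have nn : ∀ u v : n × n, 0 ≤ w u.1 u.2 v.1 v.2 / J * |x u.1 * x u.2 * x v.1 * x v.2| :=
            fun u v => mul_nonneg (div_nonneg (hw _ _ _ _) (Nat.cast_nonneg _)) (abs_nonneg _)
          refine (Finset.sum_le_sum fun u _ => Finset.sum_le_sum_of_subset_of_nonneg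
            (Finset.subset_univ _) fun v _ _ => nn u v).trans ?_
          exact Finset.sum_le_sum_of_subset_of_nonneg (Finset.subset_univ _)
            fun u _ _ => Finset.sum_nonneg fun v _ => nn u v
      _ = 1 / J * ∑ a, ∑ b, ∑ c, ∑ d, w a b c d * |x a * x b * x c * x d| := by
          simp only [Fintype.sum_prod_type, Finset.mul_sum]
          refine Finset.sum_congr rfl fun a _ => Finset.sum_congr rfl fun b _ =>
            Finset.sum_congr rfl fun c _ => Finset.sum_congr rfl fun d _ => by ring
      _ ≤ 1 / J * (κ * sqLen x ^ 2) := mul_le_mul_of_nonneg_left (hκ x) (by positivity)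
      _ = _ := by ring
  simp only [hS]
  constructor
  · rw [integral_add (integrable_const _) iZ, hZ0]
    simp
  · have e : ∀ ω, (sqLen x + Z ω) ^ 2 = (sqLen x ^ 2 + 2 * sqLen x * Z ω) + Z ω ^ 2 :=
      fun ω => by ring
    simp only [e]
    have i1 : Integrable (fun ω => sqLen x ^ 2 + 2 * sqLen x * Z ω) μ :=
      (integrable_const _).add (iZ.const_mul _)
    rw [integral_add i1 iZ2, integral_add (integrable_const _) (iZ.const_mul _),
      integral_const_mul, hZ0]
    simp only [integral_const, probReal_univ, one_smul, mul_zero, add_zero]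
    linarith

/-! ### Moments of k-wise independent functions -/

instance intUnits_measurableSingletonClass : MeasurableSingletonClass ℤˣ :=
  ⟨fun x => ⟨{x.val}, trivial, by ext; simp [Units.ext_iff]⟩⟩

lemma Int.units_cast_sq (u : ℤˣ) : (((u : ℤ) : ℝ)) ^ 2 = 1 := by
  rcases Int.units_eq_one_or u with h | h <;> simp [h]

section KWise

variable {Ω α β : Type*} [MeasurableSpace Ω] {μ : Measure Ω} [IsProbabilityMeasure μ]

omit [IsProbabilityMeasure μ] in
lemma KWiseIndependent.integral_ite_eq [Fintype β] [DecidableEq β] [MeasurableSpace β]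
    [MeasurableSingletonClass β] {k : ℕ} {h : Ω → α → β} (hh : KWiseIndependent k h μ) (i : α)
    (v : β) : ∫ ω, (if h ω i = v then 1 else 0 : ℝ) ∂μ = 1 / Fintype.card β := by
  have hm : MeasurableSet {ω | h ω i = v} :=
    ((measurable_pi_apply i).comp hh.measurable) (measurableSet_singleton v)
  rw [← hh.uniform i v, ← integral_indicator_one hm]
  congr 1 with ω
  by_cases hv : h ω i = v <;> simp [hv]

omit [IsProbabilityMeasure μ] in
lemma KWiseIndependent.indepFun [Fintype β] [MeasurableSpace β] {k : ℕ} (hk : 2 ≤ k)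
    {h : Ω → α → β} (hh : KWiseIndependent k h μ) {i i' : α} (hi : i ≠ i') :
    IndepFun (fun ω => h ω i) (fun ω => h ω i') μ := by
  classical
  have := hh.indep {i, i'} (Finset.card_le_two.trans hk)
  exact this.indepFun (i := ⟨i, by simp⟩) (j := ⟨i', by simp⟩) (by simpa using hi)

/-- For a fixed function `f`, the values of a hash function at two points satisfy
`h(i) = f(h(i'))` with probability `1 / J`. -/
lemma KWiseIndependent.integral_ite_eq_comp {J k : ℕ} (hk : 2 ≤ k) {h : Ω → α → Fin J}
    (hh : KWiseIndependent k h μ) {i i' : α} (hi : i ≠ i') (f : Fin J → Fin J) :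
    ∫ ω, (if h ω i = f (h ω i') then 1 else 0 : ℝ) ∂μ ≤ 1 / J := by
  have mi (j : α) : Measurable fun ω => h ω j := (measurable_pi_apply j).comp hh.measurable
  have e : ∀ ω, (if h ω i = f (h ω i') then 1 else 0 : ℝ) =
      ∑ v, (if h ω i = f v then 1 else 0) * (if h ω i' = v then 1 else 0) := by
    intro ω
    simp
  simp only [e]
  rw [integral_finsetSum _ fun v _ => integrable_comp_of_finite ((mi i).prodMk (mi i'))
    fun p : Fin J × Fin J => ((if p.1 = f v then 1 else 0) * (if p.2 = v then 1 else 0) : ℝ)]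
  have e2 : ∀ v, ∫ ω, ((if h ω i = f v then 1 else 0) * (if h ω i' = v then 1 else 0) : ℝ) ∂μ =
      1 / J * (1 / J) := by
    intro v
    rw [integral_mul_indepFun (mi i) (mi i') (hh.indepFun hk hi) (fun a => if a = f v then 1 else 0)
      (fun b => if b = v then 1 else 0), hh.integral_ite_eq, hh.integral_ite_eq, Fintype.card_fin]
  simp only [e2, Finset.sum_const, Finset.card_univ, Fintype.card_fin, nsmul_eq_mul]
  rcases Nat.eq_zero_or_pos J with rfl | hJ
  · simp
  · have : (J : ℝ) ≠ 0 := by positivity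
    refine le_of_eq ?_
    field_simp

/-- Two shifted values of a hash function collide modulo `J` with probability at most `1 / J`. -/
lemma KWiseIndependent.integral_ite_add_mod_eq {J k : ℕ} (hk : 2 ≤ k) {h : Ω → α → Fin J}
    (hh : KWiseIndependent k h μ) {i i' : α} (hi : i ≠ i') (A B : ℕ) :
    ∫ ω, (if ((h ω i : ℕ) + A) % J = ((h ω i' : ℕ) + B) % J then 1 else 0 : ℝ) ∂μ ≤ 1 / J := by
  classical
  -- the collision determines the value at `i` from the value at `i'`
  let f (v : Fin J) : Fin J :=
    if hv : ∃ u : Fin J, ((u : ℕ) + A) % J = ((v : ℕ) + B) % J then hv.choose else v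
  have hf : ∀ u v : Fin J, ((u : ℕ) + A) % J = ((v : ℕ) + B) % J → u = f v := by
    intro u v huv
    have hv : ∃ u : Fin J, ((u : ℕ) + A) % J = ((v : ℕ) + B) % J := ⟨u, huv⟩
    have h1 : ((u : ℕ) + A) % J = ((f v : ℕ) + A) % J := by
      simp only [f, dif_pos hv]
      exact huv.trans hv.choose_spec.symm
    have h2 : (u : ℕ) ≡ (f v : ℕ) [MOD J] := Nat.ModEq.add_right_cancel' A h1
    exact Fin.ext (h2.eq_of_lt_of_lt u.isLt (f v).isLt)
  refine le_trans (integral_mono (integrable_comp_of_finite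
      (((measurable_pi_apply i).comp hh.measurable).prodMk
        ((measurable_pi_apply i').comp hh.measurable)) fun p : Fin J × Fin J =>
        (if ((p.1 : ℕ) + A) % J = ((p.2 : ℕ) + B) % J then 1 else 0 : ℝ))
    (integrable_comp_of_finite (((measurable_pi_apply i).comp hh.measurable).prodMk
        ((measurable_pi_apply i').comp hh.measurable)) fun p : Fin J × Fin J =>
        (if p.1 = f p.2 then 1 else 0 : ℝ)) fun ω => ?_) (hh.integral_ite_eq_comp hk hi f)
  dsimp only [Function.comp]
  by_cases hc : ((h ω i : ℕ) + A) % J = ((h ω i' : ℕ) + B) % J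
  · rw [if_pos hc, if_pos (hf _ _ hc)]
  · rw [if_neg hc]
    positivity

lemma KWiseIndependent.integral_sign {k : ℕ} {s : Ω → α → ℤˣ} (hs : KWiseIndependent k s μ)
    (i : α) : ∫ ω, ((s ω i : ℤ) : ℝ) ∂μ = 0 := by
  have e : ∀ ω, ((s ω i : ℤ) : ℝ) = 2 * (if s ω i = 1 then 1 else 0) - 1 := by
    intro ω
    rcases Int.units_eq_one_or (s ω i) with h | h <;> norm_num [h]
  simp only [e]
  have hi : Integrable (fun ω => 2 * (if s ω i = 1 then 1 else 0 : ℝ)) μ :=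
    integrable_comp_of_finite ((measurable_pi_apply i).comp hs.measurable)
      fun u : ℤˣ => 2 * (if u = 1 then 1 else 0 : ℝ)
  rw [integral_sub hi (integrable_const _), integral_const_mul, hs.integral_ite_eq]
  simp [Fintype.card_units_int]

/-- A mixed moment of 4-wise independent signs vanishes if one of the indices occurs only once. -/
lemma KWiseIndependent.integral_sign_mul_eq_zero {s : Ω → α → ℤˣ} (hs : KWiseIndependent 4 s μ)
    {a b c d : α} (hb : a ≠ b) (hc : a ≠ c) (hd : a ≠ d) :
    ∫ ω, ((s ω a : ℤ) : ℝ) * (((s ω b : ℤ) : ℝ) * (((s ω c : ℤ) : ℝ) * ((s ω d : ℤ) : ℝ))) ∂μ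
      = 0 := by
  classical
  let S : Finset α := {a, b, c, d}
  have hi := hs.indep S Finset.card_le_four
  let a' : S := ⟨a, by simp [S]⟩
  let T : Finset S := {⟨b, by simp [S]⟩, ⟨c, by simp [S]⟩, ⟨d, by simp [S]⟩}
  have hT : Disjoint {a'} T := by
    simp [a', T, Subtype.ext_iff, hb, hc, hd]
  have m (i : S) : Measurable fun ω => s ω i := (measurable_pi_apply _).comp hs.measurable
  have hind := hi.indepFun_finset {a'} T hT m
  rw [integral_mul_indepFun (X := fun ω (i : ({a'} : Finset S)) => s ω i)
    (Y := fun ω (i : T) => s ω i) (measurable_pi_lambda _ fun i => m i)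
    (measurable_pi_lambda _ fun i => m i) hind
    (fun x => ((x ⟨a', by simp⟩ : ℤ) : ℝ))
    (fun y => ((y ⟨⟨b, by simp [S]⟩, by simp [T]⟩ : ℤ) : ℝ) *
      (((y ⟨⟨c, by simp [S]⟩, by simp [T]⟩ : ℤ) : ℝ) *
        ((y ⟨⟨d, by simp [S]⟩, by simp [T]⟩ : ℤ) : ℝ)))]
  rw [hs.integral_sign a, zero_mul]

lemma KWiseIndependent.integral_sign_mul_sign {s : Ω → α → ℤˣ} (hs : KWiseIndependent 4 s μ)
    {a b : α} (hab : a ≠ b) : ∫ ω, ((s ω a : ℤ) : ℝ) * ((s ω b : ℤ) : ℝ) ∂μ = 0 := by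
  rw [← hs.integral_sign_mul_eq_zero hab hab hab]
  congr 1 with ω
  linear_combination (-((s ω a : ℤ) : ℝ) * ((s ω b : ℤ) : ℝ)) * Int.units_cast_sq (s ω b)

lemma KWiseIndependent.abs_integral_sign_le [DecidableEq α] {s : Ω → α → ℤˣ}
    (hs : KWiseIndependent 4 s μ) (a b c d : α) :
    |∫ ω, ((s ω a : ℤ) : ℝ) * ((s ω b : ℤ) : ℝ) * (((s ω c : ℤ) : ℝ) * ((s ω d : ℤ) : ℝ)) ∂μ| ≤
      pairings a b c d := by
  by_cases hp : (a = b ∧ c = d) ∨ (a = c ∧ b = d) ∨ (a = d ∧ b = c)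
  · have h1 : 1 ≤ pairings a b c d := by
      have h0 : ∀ p : Prop, ∀ [Decidable p], (0 : ℝ) ≤ if p then 1 else 0 := fun p _ => by
        split_ifs <;> norm_num
      have := fun x y z w : α => mul_nonneg (h0 (x = y)) (h0 (z = w))
      rcases hp with ⟨rfl, rfl⟩ | ⟨rfl, rfl⟩ | ⟨rfl, rfl⟩
      · simp only [pairings, if_true, mul_one]
        linarith [this a c a c, this a c c a]
      · simp only [pairings, if_true, mul_one]
        linarith [this a b a b, this a b b a]
      · simp only [pairings, if_true, mul_one]
        linarith [this a b b a, this a b a b]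
    refine le_trans ?_ h1
    have := norm_integral_le_of_norm_le_const (μ := μ) (C := 1) (f := fun ω =>
      ((s ω a : ℤ) : ℝ) * ((s ω b : ℤ) : ℝ) * (((s ω c : ℤ) : ℝ) * ((s ω d : ℤ) : ℝ)))
      (Filter.Eventually.of_forall fun ω => by
        have h (u : ℤˣ) : |((u : ℤ) : ℝ)| = 1 := by
          rcases Int.units_eq_one_or u with h | h <;> simp [h]
        simp [h])
    simpa using this
  · -- if the four indices cannot be paired, one of them occurs only once
    have hl : (a ≠ b ∧ a ≠ c ∧ a ≠ d) ∨ (b ≠ a ∧ b ≠ c ∧ b ≠ d) ∨ (c ≠ a ∧ c ≠ b ∧ c ≠ d) ∨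
        (d ≠ a ∧ d ≠ b ∧ d ≠ c) := by grind
    refine le_of_eq_of_le ?_ (pairings_nonneg a b c d)
    rw [abs_eq_zero]
    rcases hl with ⟨h1, h2, h3⟩ | ⟨h1, h2, h3⟩ | ⟨h1, h2, h3⟩ | ⟨h1, h2, h3⟩ <;>
    · rw [← hs.integral_sign_mul_eq_zero h1 h2 h3]
      congr 1 with ω
      ring

end KWise

/-- If two independent pairs have independent members, then the pair of first members is
independent of the pair of second members. -/
lemma indepFun_prodMk_of_indepFun {Ω α₁ α₂ β₁ β₂ : Type*} [MeasurableSpace Ω]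
    [MeasurableSpace α₁] [MeasurableSpace α₂] [MeasurableSpace β₁] [MeasurableSpace β₂]
    [Countable α₁] [Countable α₂] [Countable β₁] [Countable β₂]
    [MeasurableSingletonClass α₁] [MeasurableSingletonClass α₂] [MeasurableSingletonClass β₁]
    [MeasurableSingletonClass β₂] {μ : Measure Ω} [IsProbabilityMeasure μ]
    {X₁ : Ω → α₁} {X₂ : Ω → α₂} {Y₁ : Ω → β₁} {Y₂ : Ω → β₂} (hX₁ : Measurable X₁)
    (hX₂ : Measurable X₂) (hY₁ : Measurable Y₁) (hY₂ : Measurable Y₂)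
    (h : IndepFun (fun ω => (X₁ ω, Y₁ ω)) (fun ω => (X₂ ω, Y₂ ω)) μ) (h₁ : IndepFun X₁ Y₁ μ)
    (h₂ : IndepFun X₂ Y₂ μ) :
    IndepFun (fun ω => (X₁ ω, X₂ ω)) (fun ω => (Y₁ ω, Y₂ ω)) μ := by
  rw [indepFun_iff_map_prod_eq_prod_map_map (hX₁.prodMk hX₂).aemeasurable
    (hY₁.prodMk hY₂).aemeasurable]
  have hX : IndepFun X₁ X₂ μ := h.comp measurable_fst measurable_fst
  have hY : IndepFun Y₁ Y₂ μ := h.comp measurable_snd measurable_snd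
  refine Measure.ext_of_singleton fun ⟨⟨a, b⟩, c, d⟩ => ?_
  rw [Measure.map_apply ((hX₁.prodMk hX₂).prodMk (hY₁.prodMk hY₂)) (measurableSet_singleton _),
    ← Set.singleton_prod_singleton, Measure.prod_prod,
    Measure.map_apply (hX₁.prodMk hX₂) (measurableSet_singleton _),
    Measure.map_apply (hY₁.prodMk hY₂) (measurableSet_singleton _)]
  have s1 : (fun ω => ((X₁ ω, X₂ ω), (Y₁ ω, Y₂ ω))) ⁻¹' ({(a, b)} ×ˢ {(c, d)}) =
      (fun ω => (X₁ ω, Y₁ ω)) ⁻¹' {(a, c)} ∩ (fun ω => (X₂ ω, Y₂ ω)) ⁻¹' {(b, d)} := by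
    ext ω
    simp
    tauto
  rw [s1, h.measure_inter_preimage_eq_mul _ _ (measurableSet_singleton _)
    (measurableSet_singleton _)]
  simp only [← Set.singleton_prod_singleton, Set.mk_preimage_prod]
  rw [hX.measure_inter_preimage_eq_mul _ _ (measurableSet_singleton _) (measurableSet_singleton _),
    hY.measure_inter_preimage_eq_mul _ _ (measurableSet_singleton _) (measurableSet_singleton _),
    h₁.measure_inter_preimage_eq_mul _ _ (measurableSet_singleton _) (measurableSet_singleton _),
    h₂.measure_inter_preimage_eq_mul _ _ (measurableSet_singleton _) (measurableSet_singleton _)]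
  ring

/-! ### CountSketch and degree-two TensorSketch -/

section Sketch

variable {Ω : Type*} [MeasurableSpace Ω] {μ : Measure Ω} [IsProbabilityMeasure μ]

lemma countSketch_moments {I J : ℕ} {h : Ω → Fin I → Fin J} {s : Ω → Fin I → ℤˣ}
    (hh : KWiseIndependent 3 h μ) (hs : KWiseIndependent 4 s μ) (hhs : IndepFun h s μ)
    (x : Fin I → ℝ) :
    ∫ ω, sqLen (countSketch (h ω) (s ω) *ᵥ x) ∂μ = sqLen x ∧
    ∫ ω, sqLen (countSketch (h ω) (s ω) *ᵥ x) ^ 2 ∂μ ≤ (1 + 9 / J) * sqLen x ^ 2 := by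
  have := signedHash_moments hh.measurable hs.measurable hhs (fun p => p)
    (fun p i => ((p i : ℤ) : ℝ)) (fun _ _ => Int.units_cast_sq _)
    (fun i i' hi => hh.integral_ite_eq_comp (by norm_num) hi id)
    (fun i i' hi => hs.integral_sign_mul_sign hi) pairings_nonneg hs.abs_integral_sign_le
    (κ := 9) (fun y => (sum_pairings_abs_le y).trans
      (mul_le_mul_of_nonneg_right (by norm_num) (sq_nonneg _))) x
  exact this

lemma tensorSketch_moments {I J : ℕ} (hJ : 0 < J) {h₁ h₂ : Ω → Fin I → Fin J}
    {s₁ s₂ : Ω → Fin I → ℤˣ} (hh₁ : KWiseIndependent 3 h₁ μ) (hh₂ : KWiseIndependent 3 h₂ μ)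
    (hs₁ : KWiseIndependent 4 s₁ μ) (hs₂ : KWiseIndependent 4 s₂ μ)
    (hhs₁ : IndepFun h₁ s₁ μ) (hhs₂ : IndepFun h₂ s₂ μ)
    (hind : IndepFun (fun ω => (h₁ ω, s₁ ω)) (fun ω => (h₂ ω, s₂ ω)) μ) (x : Fin I × Fin I → ℝ) :
    ∫ ω, sqLen (tensorSketch (h₁ ω) (h₂ ω) (s₁ ω) (s₂ ω) *ᵥ x) ∂μ = sqLen x ∧
    ∫ ω, sqLen (tensorSketch (h₁ ω) (h₂ ω) (s₁ ω) (s₂ ω) *ᵥ x) ^ 2 ∂μ ≤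
      (1 + 9 / J) * sqLen x ^ 2 := by
  let η (p : (Fin I → Fin J) × (Fin I → Fin J)) (i : Fin I × Fin I) : Fin J :=
    ⟨(((p.1 i.1 : ℕ) + 1) + ((p.2 i.2 : ℕ) + 1)) % J, Nat.mod_lt _ hJ⟩
  let σ (q : (Fin I → ℤˣ) × (Fin I → ℤˣ)) (i : Fin I × Fin I) : ℝ :=
    ((q.1 i.1 : ℤ) : ℝ) * ((q.2 i.2 : ℤ) : ℝ)
  have hS : ∀ ω, tensorSketch (h₁ ω) (h₂ ω) (s₁ ω) (s₂ ω) =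
      signedHash (η (h₁ ω, h₂ ω)) (σ (s₁ ω, s₂ ω)) := by
    intro ω
    ext j i
    simp [tensorSketch, signedHash, η, σ, Fin.ext_iff]
  have hhh : IndepFun h₁ h₂ μ := hind.comp measurable_fst measurable_fst
  have hss : IndepFun s₁ s₂ μ := hind.comp measurable_snd measurable_snd
  have mh₁ := hh₁.measurable
  have mh₂ := hh₂.measurable
  have ms₁ := hs₁.measurable
  have ms₂ := hs₂.measurable
  simp only [hS]
  refine signedHash_moments (X := fun ω => (h₁ ω, h₂ ω)) (Y := fun ω => (s₁ ω, s₂ ω))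
    (mh₁.prodMk mh₂) (ms₁.prodMk ms₂)
    (indepFun_prodMk_of_indepFun mh₁ mh₂ ms₁ ms₂ hind hhs₁ hhs₂)
    η σ (fun q i => ?_) (fun i i' hi => ?_) (fun i i' hi => ?_)
    (w := fun a b c d => pairings a.1 b.1 c.1 d.1 * pairings a.2 b.2 c.2 d.2)
    (fun _ _ _ _ => mul_nonneg (pairings_nonneg _ _ _ _) (pairings_nonneg _ _ _ _))
    (fun a b c d => ?_) sum_pairings_mul_pairings_abs_le x
  · simp only [σ, mul_pow, Int.units_cast_sq, mul_one]
  · -- freeze the hash function whose arguments may agree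
    simp only [η, Fin.mk.injEq]
    by_cases h1 : i.1 = i'.1
    · have h2 : i.2 ≠ i'.2 := fun h2 => hi (Prod.ext h1 h2)
      rw [integral_indepFun mh₂ mh₁ hhh.symm fun b a =>
        (if (((a i.1 : ℕ) + 1) + ((b i.2 : ℕ) + 1)) % J =
          (((a i'.1 : ℕ) + 1) + ((b i'.2 : ℕ) + 1)) % J then 1 else 0 : ℝ)]
      refine (integral_mono (integrable_comp_of_finite mh₁ fun a => ∫ ω,
        (if (((a i.1 : ℕ) + 1) + ((h₂ ω i.2 : ℕ) + 1)) % J =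
          (((a i'.1 : ℕ) + 1) + ((h₂ ω i'.2 : ℕ) + 1)) % J then 1 else 0 : ℝ) ∂μ)
        (integrable_const (1 / (J : ℝ))) fun ω' => ?_).trans (by simp)
      have e : ∀ a b : ℕ, a + 1 + (b + 1) = b + (a + 2) := fun a b => by ring
      simp only [e]
      exact hh₂.integral_ite_add_mod_eq (by norm_num) h2 _ _
    · rw [integral_indepFun mh₁ mh₂ hhh fun a b =>
        (if (((a i.1 : ℕ) + 1) + ((b i.2 : ℕ) + 1)) % J =
          (((a i'.1 : ℕ) + 1) + ((b i'.2 : ℕ) + 1)) % J then 1 else 0 : ℝ)]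
      refine (integral_mono (integrable_comp_of_finite mh₂ fun b => ∫ ω,
        (if (((h₁ ω i.1 : ℕ) + 1) + ((b i.2 : ℕ) + 1)) % J =
          (((h₁ ω i'.1 : ℕ) + 1) + ((b i'.2 : ℕ) + 1)) % J then 1 else 0 : ℝ) ∂μ)
        (integrable_const (1 / (J : ℝ))) fun ω' => ?_).trans (by simp)
      have e : ∀ a b : ℕ, a + 1 + (b + 1) = a + (b + 2) := fun a b => by ring
      simp only [e]
      exact hh₁.integral_ite_add_mod_eq (by norm_num) h1 _ _
  · have e : ∀ ω, σ (s₁ ω, s₂ ω) i * σ (s₁ ω, s₂ ω) i' =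
        (((s₁ ω i.1 : ℤ) : ℝ) * ((s₁ ω i'.1 : ℤ) : ℝ)) *
          (((s₂ ω i.2 : ℤ) : ℝ) * ((s₂ ω i'.2 : ℤ) : ℝ)) := fun ω => by simp only [σ]; ring
    simp only [e]
    rw [integral_mul_indepFun ms₁ ms₂ hss
      (fun p => ((p i.1 : ℤ) : ℝ) * ((p i'.1 : ℤ) : ℝ))
      (fun p => ((p i.2 : ℤ) : ℝ) * ((p i'.2 : ℤ) : ℝ))]
    by_cases h1 : i.1 = i'.1
    · rw [hs₂.integral_sign_mul_sign fun h2 => hi (Prod.ext h1 h2), mul_zero]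
    · rw [hs₁.integral_sign_mul_sign h1, zero_mul]
  · have e : ∀ ω, σ (s₁ ω, s₂ ω) a * σ (s₁ ω, s₂ ω) b * (σ (s₁ ω, s₂ ω) c * σ (s₁ ω, s₂ ω) d) =
        (((s₁ ω a.1 : ℤ) : ℝ) * ((s₁ ω b.1 : ℤ) : ℝ) *
          (((s₁ ω c.1 : ℤ) : ℝ) * ((s₁ ω d.1 : ℤ) : ℝ))) *
        (((s₂ ω a.2 : ℤ) : ℝ) * ((s₂ ω b.2 : ℤ) : ℝ) *
          (((s₂ ω c.2 : ℤ) : ℝ) * ((s₂ ω d.2 : ℤ) : ℝ))) := fun ω => by simp only [σ]; ring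
    simp only [e]
    rw [integral_mul_indepFun ms₁ ms₂ hss
      (fun p => ((p a.1 : ℤ) : ℝ) * ((p b.1 : ℤ) : ℝ) * (((p c.1 : ℤ) : ℝ) * ((p d.1 : ℤ) : ℝ)))
      (fun p => ((p a.2 : ℤ) : ℝ) * ((p b.2 : ℤ) : ℝ) * (((p c.2 : ℤ) : ℝ) * ((p d.2 : ℤ) : ℝ))),
      abs_mul]
    exact mul_le_mul (hs₁.abs_integral_sign_le _ _ _ _) (hs₂.abs_integral_sign_le _ _ _ _)
      (abs_nonneg _) (pairings_nonneg _ _ _ _)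

end Sketch

/-! ### The tree of tensor sketches -/

/-- A vector indexed by the `2 ^ (d + 1)` modes of a layer is read as a vector of pairs of
neighbouring modes. -/
def pairModes (d : ℕ) (α : Type*) : (Fin (2 ^ (d + 1)) → α) ≃ (Fin (2 ^ d) → α × α) where
  toFun c n := (c ⟨2 * (n : ℕ), by have := n.isLt; omega⟩,
    c ⟨2 * (n : ℕ) + 1, by have := n.isLt; omega⟩)
  invFun p k := if (k : ℕ) % 2 = 0 then (p ⟨(k : ℕ) / 2, by have := k.isLt; omega⟩).1
    else (p ⟨(k : ℕ) / 2, by have := k.isLt; omega⟩).2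
  left_inv c := by
    funext k
    dsimp only
    split_ifs with hk
    · congr 1
      exact Fin.ext (by simp only; omega)
    · congr 1
      exact Fin.ext (by simp only; omega)
  right_inv p := by
    funext n
    have h4 : (2 * (n : ℕ) + 1) / 2 = n := by omega
    simp [h4]

section Tree

variable {ι : Type*} [Fintype ι] {E : ι → Type*} [∀ a, Finite (E a)] [∀ a, MeasurableSpace (E a)]
  [∀ a, MeasurableSingletonClass (E a)] {P : Measure (∀ a, E a)} [IsProbabilityMeasure P]

lemma MomentBound.kronTensor (hP : iIndepFun (fun a (e : ∀ a, E a) => e a) P) {J d : ℕ} {c : ℝ}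
    (hc : 0 ≤ c) (S : Fin (2 ^ d) → Set ι)
    (T : Fin (2 ^ d) → (∀ a, E a) → Matrix (Fin J) (Fin J × Fin J) ℝ)
    (hS : Pairwise fun n n' => Disjoint (S n) (S n')) (hT : ∀ n, MomentBound P (S n) (T n) c) :
    MomentBound P (⋃ n, S n) (fun e => _root_.kronTensor d fun n => T n e) (c ^ 2 ^ d) :=
  (MomentBound.pi hP hc S T hS hT).submatrix (Equiv.refl _) (pairModes d (Fin J))

lemma MomentBound.tensorTree (hP : iIndepFun (fun a (e : ∀ a, E a) => e a) P) {J : ℕ} {c : ℝ}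
    (hc : 1 ≤ c) : ∀ {q : ℕ} (S : ((d : Fin q) × Fin (2 ^ (d : ℕ))) → Set ι)
      (T : ((d : Fin q) × Fin (2 ^ (d : ℕ))) → (∀ a, E a) → Matrix (Fin J) (Fin J × Fin J) ℝ),
      (Pairwise fun x y => Disjoint (S x) (S y)) → (∀ x, MomentBound P (S x) (T x) c) →
      MomentBound P (⋃ x, S x) (fun e => _root_.tensorTree q fun d n => T ⟨d, n⟩ e) (c ^ 2 ^ q)
  | 0, S, T, _, _ => by
    let g : (Fin (2 ^ 0) → Fin J) ≃ Fin J := Equiv.funUnique (Fin 1) (Fin J)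
    have h1 : MomentBound P (⋃ x, S x) (fun _ => (1 : Matrix (Fin J) (Fin J) ℝ)) (c ^ 2 ^ 0) := by
      refine ⟨fun _ _ _ => rfl, fun x => by simp, fun x => ?_⟩
      simp only [Matrix.one_mulVec, integral_const, probReal_univ, one_smul, pow_zero, pow_one]
      nlinarith [sq_nonneg (sqLen x)]
    convert h1.submatrix (Equiv.refl _) g using 1
    funext e
    ext r s
    simp only [_root_.tensorTree, Matrix.of_apply, Matrix.submatrix_apply, Matrix.one_apply,
      Equiv.refl_apply]
    exact if_congr eq_comm rfl rfl
  | q + 1, S, T, hS, hT => by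
    have hc0 : 0 ≤ c := zero_le_one.trans hc
    have h1 := MomentBound.tensorTree hP hc (fun x => S ⟨x.1.castSucc, x.2⟩)
      (fun x => T ⟨x.1.castSucc, x.2⟩)
      (fun x y hxy => hS fun h => hxy (by
        obtain ⟨d, n⟩ := x
        obtain ⟨d', n'⟩ := y
        simp only [Sigma.mk.injEq, Fin.castSucc_inj] at h
        obtain ⟨rfl, h⟩ := h
        simpa using h))
      (fun x => hT _)
    have h2 := MomentBound.kronTensor hP hc0 (fun n => S ⟨Fin.last q, n⟩)
      (fun n => T ⟨Fin.last q, n⟩) (fun n n' hn => hS (by simpa using hn)) (fun n => hT _)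
    have hd : Disjoint (⋃ x : (d : Fin q) × Fin (2 ^ (d : ℕ)), S ⟨x.1.castSucc, x.2⟩)
        (⋃ n, S ⟨Fin.last q, n⟩) := by
      simp only [Set.disjoint_iUnion_left, Set.disjoint_iUnion_right]
      intro n x
      exact hS fun h => (Fin.castSucc_lt_last (x.1)).ne (congrArg Sigma.fst h)
    refine (h1.mul hP h2 hd (by positivity)).mono ?_ (le_of_eq (by
      rw [← pow_add, Fin.val_last, ← mul_two, ← pow_succ]))
    refine Set.union_subset (Set.iUnion_subset fun x => ?_) (Set.iUnion_subset fun n => ?_)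
    · exact Set.subset_iUnion S ⟨x.1.castSucc, x.2⟩
    · exact Set.subset_iUnion S ⟨Fin.last q, n⟩

end Tree

/-! ### The recursive sketch -/

/-- A recursive sketch with `2 ^ q` modes has `2 ^ q` CountSketch and `2 ^ q - 1` TensorSketch
factors, each of which costs a factor `1 + 9 / J` in the fourth moment. -/
lemma recursiveSketchPow_moments {Ω : Type*} [MeasurableSpace Ω] {μ : Measure Ω}
    [IsProbabilityMeasure μ] {J q : ℕ} (hJ : 0 < J) {I : Fin (2 ^ q) → ℕ}
    {h : ∀ a : HashIndex q, Ω → Fin (hashDim J I a) → Fin J}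
    {s : ∀ a : HashIndex q, Ω → Fin (hashDim J I a) → ℤˣ}
    (hh : ∀ a, KWiseIndependent 3 (h a) μ) (hs : ∀ a, KWiseIndependent 4 (s a) μ)
    (hhs : ∀ a, IndepFun (h a) (s a) μ) (hind : iIndepFun (fun a ω => (h a ω, s a ω)) μ) :
    MomentBound (μ.map fun ω a => (h a ω, s a ω)) Set.univ
      (fun e : ∀ a : HashIndex q, (Fin (hashDim J I a) → Fin J) × (Fin (hashDim J I a) → ℤˣ) =>
        recursiveSketchPow I (fun a => (e a).1) fun a => (e a).2)
      ((1 + 9 / (J : ℝ)) ^ 2 ^ (q + 1)) := by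
  let X (ω : Ω) (a : HashIndex q) :
    (Fin (hashDim J I a) → Fin J) × (Fin (hashDim J I a) → ℤˣ) := (h a ω, s a ω)
  have hXa : ∀ a, Measurable fun ω => (h a ω, s a ω) := fun a =>
    (hh a).measurable.prodMk (hs a).measurable
  have hX : Measurable X := measurable_pi_lambda _ hXa
  have hPr : IsProbabilityMeasure (μ.map X) := Measure.isProbabilityMeasure_map hX.aemeasurable
  have hP : iIndepFun (fun a (e : ∀ a : HashIndex q,
      (Fin (hashDim J I a) → Fin J) × (Fin (hashDim J I a) → ℤˣ)) => e a) (μ.map X) := by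
    rw [iIndepFun_iff_map_fun_eq_pi_map fun a => (measurable_pi_apply a).aemeasurable]
    have h1 := hind.map_fun_eq_pi_map fun a => (hXa a).aemeasurable
    have h2 : ∀ a, (μ.map X).map (fun e => e a) = μ.map fun ω => (h a ω, s a ω) := fun a =>
      Measure.map_map (measurable_pi_apply a) hX
    simp only [h2, ← h1]
    exact Measure.map_id
  have hc : 1 ≤ 1 + 9 / (J : ℝ) := le_add_of_nonneg_right (by positivity)
  have hc0 : 0 ≤ 1 + 9 / (J : ℝ) := zero_le_one.trans hc
  have im (f : (∀ a : HashIndex q, (Fin (hashDim J I a) → Fin J) × (Fin (hashDim J I a) → ℤˣ)) → ℝ) :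
      ∫ e, f e ∂(μ.map X) = ∫ ω, f (X ω) ∂μ :=
    integral_map hX.aemeasurable (Measurable.of_discrete (f := f)).aestronglyMeasurable
  have hcount : ∀ n, MomentBound (μ.map X) {Sum.inl n}
      (fun e => countSketch (e (Sum.inl n)).1 (e (Sum.inl n)).2) (1 + 9 / (J : ℝ)) := by
    intro n
    have hm := countSketch_moments (hh (Sum.inl n)) (hs (Sum.inl n)) (hhs (Sum.inl n))
    refine ⟨fun e₁ e₂ he => ?_, fun x => ?_, fun x => ?_⟩
    · simp only [he (Sum.inl n) rfl]
    · rw [im]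
      exact (hm x).1
    · rw [im]
      exact (hm x).2
  have htensor : ∀ x : (d : Fin q) × Fin (2 ^ (d : ℕ)),
      MomentBound (μ.map X) {Sum.inr (x, false), Sum.inr (x, true)}
      (fun e => tensorSketch (e (Sum.inr (x, false))).1 (e (Sum.inr (x, true))).1
        (e (Sum.inr (x, false))).2 (e (Sum.inr (x, true))).2) (1 + 9 / (J : ℝ)) := by
    intro x
    have hm := tensorSketch_moments hJ (hh (Sum.inr (x, false))) (hh (Sum.inr (x, true)))
      (hs (Sum.inr (x, false))) (hs (Sum.inr (x, true))) (hhs (Sum.inr (x, false)))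
      (hhs (Sum.inr (x, true))) (hind.indepFun (by simp))
    refine ⟨fun e₁ e₂ he => ?_, fun y => ?_, fun y => ?_⟩
    · simp only [he (Sum.inr (x, false)) (Or.inl rfl), he (Sum.inr (x, true)) (Or.inr rfl)]
    · rw [im]
      exact (hm y).1
    · rw [im]
      exact (hm y).2
  have h1 := MomentBound.tensorTree hP hc _ _ (fun x y hxy => by simp [Ne.symm hxy]) htensor
  have h2 := MomentBound.pi hP hc0 _ _ (fun n n' hn => by simpa using hn) hcount
  refine (h1.mul hP h2 ?_ (by positivity)).mono (Set.subset_univ _)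
    (le_of_eq (by rw [← pow_add]; congr 1; ring))
  simp

/-- Tensoring with copies of the first basis vector is an isometry. -/
lemma sqLen_padMatrix_mulVec {N : ℕ} (hN : 1 ≤ N) {I : Fin N → ℕ} (hI : ∀ j, 1 ≤ I j)
    (x : (∀ j, Fin (I j)) → ℝ) : sqLen (padMatrix I *ᵥ x) = sqLen x := by
  have hle : N ≤ 2 ^ Nat.clog 2 N := Nat.le_pow_clog (by norm_num) N
  have hsup : 0 < Finset.univ.sup I :=
    lt_of_lt_of_le (hI ⟨0, hN⟩) (Finset.le_sup (Finset.mem_univ _))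
  have hpad : ∀ n : Fin (2 ^ Nat.clog 2 N), ∀ hn : (n : ℕ) < N, paddedDim I n = I ⟨n, hn⟩ :=
    fun n hn => dif_pos hn
  -- the multi-index of the padded tensor that carries the coordinate `i` of `x`
  let pad (i : ∀ j, Fin (I j)) (n : Fin (2 ^ Nat.clog 2 N)) : Fin (paddedDim I n) :=
    if hn : (n : ℕ) < N then ⟨i ⟨n, hn⟩, by rw [hpad n hn]; exact (i ⟨n, hn⟩).isLt⟩
    else ⟨0, by rw [paddedDim, dif_neg hn]; exact hsup⟩
  have hpadv : ∀ i n, ((pad i n : Fin _) : ℕ) =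
      if hn : (n : ℕ) < N then (i ⟨n, hn⟩ : ℕ) else 0 := by
    intro i n
    simp only [pad]
    split_ifs <;> rfl
  have hinj : Function.Injective pad := by
    intro i i' hii
    funext j
    have h1 := congrArg (fun p => ((p ⟨j, j.isLt.trans_le hle⟩ : Fin _) : ℕ)) hii
    simp only [hpadv, j.isLt, dif_pos] at h1
    exact Fin.ext h1
  have hentry : ∀ c i, padMatrix I c i = if c = pad i then 1 else 0 := by
    intro c i
    simp only [padMatrix, Matrix.of_apply, ← hpadv]
    by_cases hc : c = pad i
    · simp [hc]
    · rw [if_neg hc]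
      obtain ⟨n, hn⟩ := Function.ne_iff.1 hc
      exact Finset.prod_eq_zero (Finset.mem_univ n) (if_neg fun h => hn (Fin.ext h))
  have hval : ∀ i, (padMatrix I *ᵥ x) (pad i) = x i := by
    intro i
    simp [Matrix.mulVec, dotProduct, hentry, hinj.eq_iff]
  have hzero : ∀ c, c ∉ Finset.univ.image pad → (padMatrix I *ᵥ x) c = 0 := by
    intro c hc
    refine Finset.sum_eq_zero fun i _ => ?_
    have : padMatrix I c i = 0 := by rw [hentry, if_neg fun h => hc (by simp [h])]
    simp [this]
  simp only [sqLen]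
  rw [← Finset.sum_subset (Finset.subset_univ (Finset.univ.image pad))
    fun c _ hc => by rw [hzero c hc]; norm_num, Finset.sum_image fun i _ i' _ h => hinj h]
  simp only [hval]

/-! ### From moments to subspace embeddings -/

lemma sqLen_eq_dotProduct {n : Type*} [Fintype n] (v : n → ℝ) : sqLen v = v ⬝ᵥ v := by
  simp [sqLen, dotProduct, sq]

lemma sqLen_sum_smul {n κ : Type*} [Fintype n] [Fintype κ] (c : κ → ℝ) (v : κ → n → ℝ) :
    sqLen (∑ k, c k • v k) = ∑ k, ∑ l, c k * c l * (v k ⬝ᵥ v l) := by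
  simp only [sqLen_eq_dotProduct, sum_dotProduct, dotProduct_sum, smul_dotProduct,
    dotProduct_smul, smul_eq_mul, Finset.mul_sum, mul_assoc]
  refine Finset.sum_congr rfl fun k _ => Finset.sum_congr rfl fun l _ => ?_
  rw [dotProduct_comm]

/-- The error `⟨M x, M y⟩ - ⟨x, y⟩` that a matrix `M` makes on inner products. -/
def innerError {m n : Type*} [Fintype m] [Fintype n] (M : Matrix m n ℝ) (x y : n → ℝ) : ℝ :=
  (M *ᵥ x) ⬝ᵥ (M *ᵥ y) - x ⬝ᵥ y

lemma innerError_polarization {m n : Type*} [Fintype m] [Fintype n] (M : Matrix m n ℝ)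
    (x y : n → ℝ) : 4 * innerError M x y =
      (sqLen (M *ᵥ (x + y)) - sqLen (x + y)) - (sqLen (M *ᵥ (x - y)) - sqLen (x - y)) := by
  simp only [innerError, sqLen_eq_dotProduct, Matrix.mulVec_add, Matrix.mulVec_sub, add_dotProduct,
    sub_dotProduct, dotProduct_add, dotProduct_sub]
  rw [dotProduct_comm (M *ᵥ y) (M *ᵥ x), dotProduct_comm y x]
  ring

lemma sqLen_mulVec_sum_sub {m n κ : Type*} [Fintype m] [Fintype n] [Fintype κ] (M : Matrix m n ℝ)
    (c : κ → ℝ) (u : κ → n → ℝ) :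
    sqLen (M *ᵥ ∑ k, c k • u k) - sqLen (∑ k, c k • u k) =
      ∑ k, ∑ l, c k * c l * innerError M (u k) (u l) := by
  have hM : M *ᵥ ∑ k, c k • u k = ∑ k, c k • (M *ᵥ u k) := by
    simp only [Matrix.mulVec_sum, Matrix.mulVec_smul]
  rw [hM, sqLen_sum_smul, sqLen_sum_smul]
  simp only [← Finset.sum_sub_distrib, innerError, mul_sub]

/-- The column space of `A` is spanned by at most `R` orthonormal vectors. Orthonormality enters
only through the parallelogram identity and Parseval's identity. -/
lemma exists_orthonormal_columns {n : Type*} [Fintype n] {R : ℕ} (A : Matrix n (Fin R) ℝ) :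
    ∃ r ≤ R, ∃ u : Fin r → n → ℝ, (∀ k l, sqLen (u k + u l) + sqLen (u k - u l) = 4) ∧
      ∀ x, ∃ c : Fin r → ℝ, A *ᵥ x = ∑ k, c k • u k ∧ sqLen (A *ᵥ x) = sqLen c := by
  classical
  let L : EuclideanSpace ℝ (Fin R) →ₗ[ℝ] EuclideanSpace ℝ n := Matrix.toLpLin 2 2 A
  let b := stdOrthonormalBasis ℝ (LinearMap.range L)
  refine ⟨Module.finrank ℝ (LinearMap.range L), ?_, fun k => WithLp.ofLp (b k : EuclideanSpace ℝ n),
    fun k l => ?_, fun x => ?_⟩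
  · simpa using LinearMap.finrank_range_le L
  · have hk : ‖(b k : EuclideanSpace ℝ n)‖ = 1 := b.orthonormal.1 k
    have hl : ‖(b l : EuclideanSpace ℝ n)‖ = 1 := b.orthonormal.1 l
    have := parallelogram_law_with_norm ℝ (b k : EuclideanSpace ℝ n) (b l : EuclideanSpace ℝ n)
    rw [hk, hl] at this
    simp only [sqLen_eq_norm_sq, ← WithLp.ofLp_add, ← WithLp.ofLp_sub, WithLp.toLp_ofLp]
    linarith
  · let v : LinearMap.range L := ⟨L (WithLp.toLp 2 x), LinearMap.mem_range_self _ _⟩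
    have hv : WithLp.ofLp (v : EuclideanSpace ℝ n) = A *ᵥ x := by
      simp [v, L]
    refine ⟨fun k => b.repr v k, ?_, ?_⟩
    · have h1 := congrArg (fun w : LinearMap.range L => WithLp.ofLp (w : EuclideanSpace ℝ n))
        (b.sum_repr v)
      simp only [hv] at h1
      rw [← h1]
      simp
    · rw [← hv, sqLen_eq_norm_sq, sqLen_eq_norm_sq, WithLp.toLp_ofLp]
      have h2 : ‖b.repr v‖ = ‖v‖ := b.repr.norm_map v
      exact (congrArg (· ^ 2) h2).symm

/-- By the Cauchy–Schwarz inequality, the relative error on the column space is at most the Frobenius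
norm of the errors on the vectors `u k`. -/
lemma isSubspaceEmbedding_of_sum_sq_le {m n κ : Type*} [Fintype m] [Fintype n] [Fintype κ]
    {R : ℕ} {A : Matrix n (Fin R) ℝ} {M : Matrix m n ℝ} {γ : ℝ} (hγ : 0 ≤ γ) {u : κ → n → ℝ}
    (hu : ∀ x, ∃ c : κ → ℝ, A *ᵥ x = ∑ k, c k • u k ∧ sqLen (A *ᵥ x) = sqLen c)
    (h : ∑ k, ∑ l, innerError M (u k) (u l) ^ 2 ≤ γ ^ 2) : IsSubspaceEmbedding γ M A := by
  intro x
  obtain ⟨c, hc, hcl⟩ := hu x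
  rw [← Matrix.mulVec_mulVec, ← sqLen_eq_norm_sq, ← sqLen_eq_norm_sq]
  refine abs_le_of_sq_le_sq ?_ (mul_nonneg hγ (sqLen_nonneg _))
  have key : sqLen (M *ᵥ (A *ᵥ x)) - sqLen (A *ᵥ x) =
      ∑ p : κ × κ, (c p.1 * c p.2) * innerError M (u p.1) (u p.2) := by
    rw [hc, sqLen_mulVec_sum_sub, Fintype.sum_prod_type]
  have hcc : ∑ p : κ × κ, (c p.1 * c p.2) ^ 2 = sqLen c ^ 2 := by
    simp only [sqLen, sq (∑ i, c i ^ 2), Finset.sum_mul_sum, Fintype.sum_prod_type, mul_pow]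
  rw [key]
  calc (∑ p : κ × κ, (c p.1 * c p.2) * innerError M (u p.1) (u p.2)) ^ 2
      ≤ (∑ p : κ × κ, (c p.1 * c p.2) ^ 2) * ∑ p : κ × κ, innerError M (u p.1) (u p.2) ^ 2 :=
        Finset.sum_mul_sq_le_sq_mul_sq _ _ _
    _ ≤ sqLen c ^ 2 * γ ^ 2 := by
        rw [hcc, Fintype.sum_prod_type]
        exact mul_le_mul_of_nonneg_left h (sq_nonneg _)
    _ = (γ * sqLen (A *ᵥ x)) ^ 2 := by rw [hcl]; ring

section Embedding

variable {C : Type*} [MeasurableSpace C] [Finite C] [MeasurableSingletonClass C] {P : Measure C}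
  [IsProbabilityMeasure P] {m n : Type*} [Fintype m] [Fintype n] {M : C → Matrix m n ℝ} {c : ℝ}

lemma integral_sq_sub_le (h2 : ∀ x, ∫ e, sqLen (M e *ᵥ x) ∂P = sqLen x)
    (h4 : ∀ x, ∫ e, sqLen (M e *ᵥ x) ^ 2 ∂P ≤ c * sqLen x ^ 2) (x : n → ℝ) :
    ∫ e, (sqLen (M e *ᵥ x) - sqLen x) ^ 2 ∂P ≤ (c - 1) * sqLen x ^ 2 := by
  have e1 : ∀ e, (sqLen (M e *ᵥ x) - sqLen x) ^ 2 =
      sqLen (M e *ᵥ x) ^ 2 - (2 * sqLen x * sqLen (M e *ᵥ x) - sqLen x ^ 2) := fun e => by ring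
  simp only [e1]
  rw [integral_sub Integrable.of_finite Integrable.of_finite,
    integral_sub Integrable.of_finite Integrable.of_finite, integral_const_mul, h2]
  simp only [integral_const, probReal_univ, one_smul]
  linarith [h4 x]

/-- The hypothesis holds for any two members of an orthonormal family, equal or not. -/
lemma integral_innerError_sq_le (hc : 1 ≤ c) (h2 : ∀ x, ∫ e, sqLen (M e *ᵥ x) ∂P = sqLen x)
    (h4 : ∀ x, ∫ e, sqLen (M e *ᵥ x) ^ 2 ∂P ≤ c * sqLen x ^ 2) {x y : n → ℝ}
    (hxy : sqLen (x + y) + sqLen (x - y) = 4) :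
    ∫ e, innerError (M e) x y ^ 2 ∂P ≤ 2 * (c - 1) := by
  have pt : ∀ e, innerError (M e) x y ^ 2 ≤
      1 / 8 * ((sqLen (M e *ᵥ (x + y)) - sqLen (x + y)) ^ 2 +
        (sqLen (M e *ᵥ (x - y)) - sqLen (x - y)) ^ 2) := by
    intro e
    have := innerError_polarization (M e) x y
    set p := sqLen (M e *ᵥ (x + y)) - sqLen (x + y)
    set q := sqLen (M e *ᵥ (x - y)) - sqLen (x - y)
    have h : innerError (M e) x y = (p - q) / 4 := by linarith
    rw [h]
    nlinarith [sq_nonneg (p + q)]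
  refine (integral_mono Integrable.of_finite Integrable.of_finite pt).trans ?_
  rw [integral_const_mul, integral_add Integrable.of_finite Integrable.of_finite]
  have ha := integral_sq_sub_le h2 h4 (x + y)
  have hb := integral_sq_sub_le h2 h4 (x - y)
  have hsq : sqLen (x + y) ^ 2 + sqLen (x - y) ^ 2 ≤ 16 := by
    have := mul_nonneg (sqLen_nonneg (x + y)) (sqLen_nonneg (x - y))
    calc sqLen (x + y) ^ 2 + sqLen (x - y) ^ 2
        ≤ (sqLen (x + y) + sqLen (x - y)) ^ 2 := by nlinarith
      _ = 16 := by rw [hxy]; norm_num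
  have := mul_le_mul_of_nonneg_left hsq (sub_nonneg.2 hc)
  linarith

/-- A random matrix that preserves squared lengths in the mean and has small fourth moments is a
subspace embedding with high probability: Markov's inequality is applied to the squared Frobenius
norm of the errors on an orthonormal basis of the column space. -/
lemma measureReal_isSubspaceEmbedding_ge (hc : 1 ≤ c)
    (h2 : ∀ x, ∫ e, sqLen (M e *ᵥ x) ∂P = sqLen x)
    (h4 : ∀ x, ∫ e, sqLen (M e *ᵥ x) ^ 2 ∂P ≤ c * sqLen x ^ 2) {R : ℕ} (A : Matrix n (Fin R) ℝ)
    {γ : ℝ} (hγ : 0 < γ) :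
    1 - 2 * (c - 1) * (R : ℝ) ^ 2 / γ ^ 2 ≤ P.real {e | IsSubspaceEmbedding γ (M e) A} := by
  obtain ⟨r, hr, u, hu, hA⟩ := exists_orthonormal_columns A
  let F (e : C) : ℝ := ∑ k, ∑ l, innerError (M e) (u k) (u l) ^ 2
  have hF : ∫ e, F e ∂P ≤ 2 * (c - 1) * (R : ℝ) ^ 2 := by
    calc ∫ e, F e ∂P = ∑ k, ∑ l, ∫ e, innerError (M e) (u k) (u l) ^ 2 ∂P := by
          simp only [F]
          rw [integral_finsetSum _ fun _ _ => Integrable.of_finite]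
          exact Finset.sum_congr rfl fun k _ =>
            integral_finsetSum _ fun _ _ => Integrable.of_finite
      _ ≤ ∑ _k : Fin r, ∑ _l : Fin r, 2 * (c - 1) :=
          Finset.sum_le_sum fun k _ => Finset.sum_le_sum fun l _ =>
            integral_innerError_sq_le hc h2 h4 (hu k l)
      _ = 2 * (c - 1) * (r : ℝ) ^ 2 := by
          simp only [Finset.sum_const, Finset.card_univ, Fintype.card_fin, nsmul_eq_mul]
          ring
      _ ≤ 2 * (c - 1) * (R : ℝ) ^ 2 := by
          have : (r : ℝ) ≤ R := by exact_mod_cast hr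
          have hc' : 0 ≤ c - 1 := sub_nonneg.2 hc
          gcongr
  have hmarkov : γ ^ 2 * P.real {e | γ ^ 2 ≤ F e} ≤ 2 * (c - 1) * (R : ℝ) ^ 2 :=
    (mul_meas_ge_le_integral_of_nonneg (Filter.Eventually.of_forall fun e =>
      Finset.sum_nonneg fun k _ => Finset.sum_nonneg fun l _ => sq_nonneg _)
      Integrable.of_finite _).trans hF
  have hbad : P.real {e | γ ^ 2 ≤ F e} ≤ 2 * (c - 1) * (R : ℝ) ^ 2 / γ ^ 2 := by
    rw [le_div_iff₀ (by positivity), mul_comm]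
    exact hmarkov
  have hmeas : MeasurableSet {e | γ ^ 2 ≤ F e} := Set.Finite.measurableSet (Set.toFinite _)
  have hsub : {e | γ ^ 2 ≤ F e}ᶜ ⊆ {e | IsSubspaceEmbedding γ (M e) A} := fun e he =>
    isSubspaceEmbedding_of_sum_sq_le hγ.le hA (lt_of_not_ge fun h => he h).le
  have hcompl := probReal_compl_eq_one_sub (μ := P) hmeas
  have := measureReal_mono (μ := P) hsub
  linarith

end Embedding

/-- The exponent is at most `4 N`, since `2 ^ ⌈log₂ N⌉ ≤ 2 N`, and `exp x ≤ 1 + 2 x` for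
`x = 36 N / J ≤ 1`. -/
lemma one_add_div_pow_sub_one_le {N J : ℕ} (hN : 1 ≤ N) (hJ : 36 * (N : ℝ) ≤ J) :
    (1 + 9 / (J : ℝ)) ^ 2 ^ (Nat.clog 2 N + 1) - 1 ≤ 72 * N / J := by
  have hN' : (1 : ℝ) ≤ N := by exact_mod_cast hN
  have hJ0 : (0 : ℝ) < J := by linarith
  have hpow : 2 ^ (Nat.clog 2 N + 1) ≤ 4 * N := by
    have h : 2 ^ Nat.clog 2 N ≤ 2 * N := by
      rcases hN.eq_or_lt with rfl | h1
      · simp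
      · have h2 := Nat.pow_pred_clog_lt_self (b := 2) (by norm_num) h1
        have h3 : 0 < Nat.clog 2 N := Nat.clog_pos (by norm_num) h1
        obtain ⟨k, hk⟩ := Nat.exists_eq_succ_of_ne_zero h3.ne'
        rw [hk] at h2 ⊢
        simp only [Nat.succ_eq_add_one, Nat.pred_eq_sub_one, Nat.add_sub_cancel, pow_succ] at h2 ⊢
        omega
    rw [pow_succ]
    omega
  have hbase : 1 ≤ 1 + 9 / (J : ℝ) := le_add_of_nonneg_right (by positivity)
  have hx1 : 36 * (N : ℝ) / J ≤ 1 := (div_le_one hJ0).2 hJ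
  have hx0 : 0 ≤ 36 * (N : ℝ) / J := by positivity
  have hexp := Real.abs_exp_sub_one_le (x := 36 * (N : ℝ) / J) (by rwa [abs_of_nonneg hx0])
  rw [abs_of_nonneg hx0] at hexp
  calc (1 + 9 / (J : ℝ)) ^ 2 ^ (Nat.clog 2 N + 1) - 1
      ≤ (1 + 9 / (J : ℝ)) ^ (4 * N) - 1 := sub_le_sub_right (pow_le_pow_right₀ hbase hpow) 1
    _ ≤ Real.exp (9 / (J : ℝ)) ^ (4 * N) - 1 := by
        refine sub_le_sub_right (pow_le_pow_left₀ (by positivity) ?_ _) 1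
        linarith [Real.add_one_le_exp (9 / (J : ℝ))]
    _ = Real.exp (36 * (N : ℝ) / J) - 1 := by
        rw [← Real.exp_nat_mul]
        congr 2
        push_cast
        ring
    _ ≤ 2 * (36 * (N : ℝ) / J) := (le_abs_self _).trans hexp
    _ = _ := by ring

theorem mainTheorem7 :
    ∃ C : ℝ, 0 < C ∧
      ∀ (Ω : Type*) [MeasurableSpace Ω] (μ : Measure Ω) [IsProbabilityMeasure μ]
        (N : ℕ) (_ : 1 ≤ N) (I : Fin N → ℕ) (_ : ∀ j, 1 ≤ I j) (R J : ℕ)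
        (γ δ : ℝ) (_ : 0 < γ) (_ : γ < 1) (_ : 0 < δ) (_ : δ < 1)
        (A : Matrix (∀ j, Fin (I j)) (Fin R) ℝ)
        (Ψ : Ω → Matrix (Fin J) (∀ j, Fin (I j)) ℝ) (_ : IsRecursiveSketch μ I Ψ),
        C * ((N : ℝ) * (R : ℝ) ^ 2 / (γ ^ 2 * δ)) ≤ (J : ℝ) →
          1 - δ ≤ μ.real {ω | IsSubspaceEmbedding γ (Ψ ω) A} := by
  refine ⟨144, by norm_num, ?_⟩
  intro Ω _ μ _ N hN I hI R J γ δ hγ hγ1 hδ hδ1 A Ψ hΨ hJ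
  rcases Nat.eq_zero_or_pos R with rfl | hR
  · -- without columns there is nothing to embed, and `J = 0` is possible
    have : {ω | IsSubspaceEmbedding γ (Ψ ω) A} = Set.univ := by
      refine Set.eq_univ_of_forall fun ω x => ?_
      have h1 : (Ψ ω * A).mulVec x = 0 := by ext; simp [Matrix.mulVec, dotProduct]
      have h2 : A.mulVec x = 0 := by ext; simp [Matrix.mulVec, dotProduct]
      rw [h1, h2]
      simp
    rw [this, probReal_univ]
    linarith
  obtain ⟨h, s, hh, hs, hhs, hind, hΨeq⟩ := hΨ
  have hN' : (1 : ℝ) ≤ N := by exact_mod_cast hN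
  have hR' : (1 : ℝ) ≤ R := by exact_mod_cast hR
  have hJ' : 144 * ((N : ℝ) * (R : ℝ) ^ 2) ≤ J * (γ ^ 2 * δ) := by
    rw [← mul_div_assoc, div_le_iff₀ (by positivity)] at hJ
    exact hJ
  have hJN : 36 * (N : ℝ) ≤ J := by
    have h1 : (N : ℝ) * 1 ≤ N * (R : ℝ) ^ 2 :=
      mul_le_mul_of_nonneg_left (one_le_pow₀ hR') (by positivity)
    have h2 : (J : ℝ) * (γ ^ 2 * δ) ≤ J * 1 :=
      mul_le_mul_of_nonneg_left
        (mul_le_one₀ (pow_le_one₀ hγ.le hγ1.le) hδ.le hδ1.le) (Nat.cast_nonneg _)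
    linarith
  have hJ0 : (0 : ℝ) < J := by linarith
  have hJpos : 0 < J := by exact_mod_cast hJ0
  have hmom := recursiveSketchPow_moments hJpos hh hs hhs hind
  let X (ω : Ω) (a : HashIndex (Nat.clog 2 N)) : (Fin (hashDim J (paddedDim I) a) → Fin J) ×
    (Fin (hashDim J (paddedDim I) a) → ℤˣ) := (h a ω, s a ω)
  have hX : Measurable X := measurable_pi_lambda _ fun a =>
    (hh a).measurable.prodMk (hs a).measurable
  have hPr : IsProbabilityMeasure (μ.map X) := Measure.isProbabilityMeasure_map hX.aemeasurable
  have hc : 1 ≤ (1 + 9 / (J : ℝ)) ^ 2 ^ (Nat.clog 2 N + 1) :=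
    one_le_pow₀ (le_add_of_nonneg_right (by positivity))
  have hemb := measureReal_isSubspaceEmbedding_ge (P := μ.map X)
    (M := fun e => recursiveSketchPow (paddedDim I) (fun a => (e a).1) (fun a => (e a).2) *
      padMatrix I) hc
    (fun x => by
      simp only [← Matrix.mulVec_mulVec]
      exact (hmom.second _).trans (sqLen_padMatrix_mulVec hN hI x))
    (fun x => by
      simp only [← Matrix.mulVec_mulVec]
      refine (hmom.fourth _).trans_eq ?_
      rw [sqLen_padMatrix_mulVec hN hI x]) A hγ
  rw [map_measureReal_apply hX (Set.Finite.measurableSet (Set.toFinite _))] at hemb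
  have hset : X ⁻¹' {e | IsSubspaceEmbedding γ (recursiveSketchPow (paddedDim I)
      (fun a => (e a).1) (fun a => (e a).2) * padMatrix I) A} =
      {ω | IsSubspaceEmbedding γ (Ψ ω) A} := by
    ext ω
    simp only [Set.mem_preimage, Set.mem_ofPred_eq, hΨeq, X]
  rw [hset] at hemb
  refine le_trans ?_ hemb
  have hle := one_add_div_pow_sub_one_le hN hJN
  have : 2 * ((1 + 9 / (J : ℝ)) ^ 2 ^ (Nat.clog 2 N + 1) - 1) * (R : ℝ) ^ 2 / γ ^ 2 ≤ δ := by
    rw [div_le_iff₀ (by positivity)]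
    calc 2 * ((1 + 9 / (J : ℝ)) ^ 2 ^ (Nat.clog 2 N + 1) - 1) * (R : ℝ) ^ 2
        ≤ 2 * (72 * N / J) * (R : ℝ) ^ 2 := by gcongr
      _ = 144 * ((N : ℝ) * (R : ℝ) ^ 2) / J := by ring
      _ ≤ δ * γ ^ 2 := by
        rw [div_le_iff₀ hJ0]
        exact hJ'.trans_eq (by ring)
  linarith
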